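/- **Setting.** Let $\mathbb N=\{1,2,\dots\}$. Let $a=(a_j)_{j\ge1}$ be a non-decreasing sequence of positive reals with $a_j\to\infty$, let $b=(b_j)_{j\ge 1}$ be a sequence of positive reals, and let $0<C_0\le 1\le C_1<\infty$. Put $\mathcal B(b)=\{\nu\in\mathbb R^{\mathbb N}: C_0b_j\le \nu_j\le C_1b_j\ \forall j\}$ (so $\mathcal B(b)=\{b\}$ if $C_0=C_1=1$), $\mathcal E_a=\{\theta\in\ell^2(\mathbb N):\sum_j a_j^2\theta_j^2\le 1\}$ and $\Theta_a(r)=\{\theta\in\mathcal E_a:\|\theta\|\ge r\}$. For $\varepsilon,\sigma>0$, $\theta\in\ell^2(\mathbb N)$ and $\nu\in\mathcal B(b)$, let $\mathbb P_{\theta,\nu}$ be the law of the observations $$Y_j=\nu_j\theta_j+\varepsilon\xi_j,\qquad X_j=\nu_j+\sigma\eta_j,\qquad j\in\mathbb N,$$ with independent standard Gaussian $\xi_j,\eta_j$. The benchmark $\theta_0\in\mathcal E_a\setminus\{0\}$ is known, and the singular values $\nu$ are known only to lie in $\mathcal B(b)$. A procedure $\Psi$ assigns to each $\theta_0\in\mathcal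 E_a\setminus\{0\}$ a measurable $\{0,1\}$-valued function $\Psi_{\theta_0}$ of $(Y,X)$ that tests $H_0:\theta=\theta_0$ against $H_1:\theta-\theta_0\in\Theta_a(r)$. It has level $\alpha$ if $\mathbb P_{\theta_0,\nu}(\Psi_{\theta_0}=1)\le\alpha$ for all $\theta_0\in\mathcal E_a\setminus\{0\}$ and $\nu\in\mathcal B(b)$. The minimax separation radius $\tilde r_{\varepsilon,\sigma}$ is the infimum, over all procedures $\Psi$ of level $\alpha$, of $$\inf\Big\{r>0:\ \sup_{\theta_0\in\mathcal E_a\setminus\{0\}}\ \sup_{\theta-\theta_0\in\Theta_a(r)}\ \sup_{\nu\in\mathcal B(b)}\mathbb P_{\theta,\nu}(\Psi_{\theta_0}=0)\le\beta\Big\}.$$ **Constants and bandwidths.** Let $\kappa=5(3\pi^2+12)/6$, $h_{0,j}=18\sqrt{\ln(\kappa j^2/\alpha)}+\sqrt{2\ln(10/\alpha)}$, $h_{1,j}=16\sqrt{\ln(\kappa j^2/\alpha)}$, $$M_0=\inf\{j: b_j\le\sigma h_{0,j}\}-1,\qquad M_1=\inf\{j:b_j\le \sigma h_{1,j}\}\qquad(\inf\emptyset=\infty),$$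 $$\tilde C=\tfrac{16}{C_0^{2}}\Big(3\sqrt{\ln(2/\alpha)}+2\ln(2/\alpha)+3\sqrt{\ln(2/\beta)}\Big),$$ $$C_{\alpha,\beta}=\ln\big(1+4(1-\alpha-\beta)^2\big),\qquad c_{\alpha,\beta}=\sqrt{2\ln\big(1+4(1-\alpha-\beta)^2\big)},$$ $$M_2=\sup\Big\{D\in\mathbb N:\ C_{\alpha,\beta}\,\sigma b_D^{-1}\le 2,\ \ \frac1{\sigma\sqrt{2\pi}}\int_{C_0b_D}^{C_1b_D}e^{-(t-b_D)^2/(2\sigma^2)}dt\ \ge\ \frac1{\sqrt{1+4(1-\alpha-\beta)^2}}\Big\}\qquad(\sup\emptyset=0),$$ and $a_0^{-2}:=+\infty$; a maximum over the empty set is $0$. **Theorem.** Let $0<\alpha\le\beta<1$. (i) Suppose that $C_0=C_1=1$, or that there is a constant $K$ with $(a_jb_j)^{-1}\le K\max\{1,(a_kb_k)^{-1}\}$ for all $j\le k$. Then there is $\sigma_0\in\,]0,1[$ (depending on $\alpha,\beta,a,b,C_0,C_1$) such that, for all $0<\sigma\le\sigma_0$ and all $\varepsilon>0$, $$\tilde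 r_{\varepsilon,\sigma}^2\le\inf_{D\in\mathbb N}\Big[\tilde C\,\varepsilon^2\sqrt{\textstyle\sum_{j=1}^{D\wedge M_1}b_j^{-4}}+\big(7+4\sqrt{\ln(2/\alpha)}\big)\big[\sigma^2\ln^{3/2}(1/\sigma)\vee a_{D\wedge M_0}^{-2}\big]\Big].$$ (ii) Suppose that $\alpha+\beta<1$ and that $b$ is non-increasing. Then, for all $\varepsilon,\sigma>0$, $$\tilde r_{\varepsilon,\sigma}^2\ge\Big\{\frac{C_{\alpha,\beta}^2}{16}\,\sigma^2\max_{1\le D\le M_2}b_D^{-2}a_D^{-2}\Big\}\vee\Big\{\sup_{D\in\mathbb N}\Big[c_{\alpha,\beta}\,\varepsilon^2\sqrt{\textstyle\sum_{j=1}^{D}b_j^{-4}}\ \wedge\ a_D^{-2}\Big]\Big\}.$$ -/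

import Mathlib

open MeasureTheory ProbabilityTheory Filter
open scoped ENNReal NNReal

noncomputable section

namespace GoF

/-- Square-summable real sequences indexed by `{1, 2, …}`, with the Hilbert norm. -/
abbrev EllTwo : Type := lp (fun _ : ℕ+ => ℝ) 2

/-- The space of observations `(Y_j, X_j)_{j ≥ 1}`. -/
abbrev Obs : Type := ℕ+ → ℝ × ℝ

/-- The joint law `P_{θ,b}` of the observations `Y_j = b_j θ_j + ε ξ_j`, `X_j = b_j + σ η_j`,
with `ξ_j`, `η_j` (`j ≥ 1`) independent standard Gaussian variables. -/
def law (ε σ : ℝ) (θ : EllTwo) (b : ℕ+ → ℝ) : Measure Obs :=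
  Measure.infinitePi fun j : ℕ+ =>
    (gaussianReal (b j * θ j) (Real.toNNReal (ε ^ 2))).prod
      (gaussianReal (b j) (Real.toNNReal (σ ^ 2)))

/-- The ellipsoid `E_a = {θ ∈ ℓ² : ∑ a_j² θ_j² ≤ 1}`. -/
def ellipsoid (a : ℕ+ → ℝ) : Set EllTwo :=
  {θ | Summable (fun j : ℕ+ => a j ^ 2 * θ j ^ 2) ∧ ∑' j : ℕ+, a j ^ 2 * θ j ^ 2 ≤ 1}

/-- `Θ_a(r)`: the ellipsoid with a ball of radius `r` removed. -/
def alternatives (a : ℕ+ → ℝ) (r : ℝ) : Set EllTwo :=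
  {θ | θ ∈ ellipsoid a ∧ r ≤ ‖θ‖}

/-- `B(b)`: the positive sequences that are comparable to `b` with constants `C₀`, `C₁`.
The true (unknown) sequence of singular values ranges over this set. For `C₀ = C₁ = 1` it is
`{b}`. -/
def operatorClass (C₀ C₁ : ℝ) (b : ℕ+ → ℝ) : Set (ℕ+ → ℝ) :=
  {ν | ∀ j, C₀ * b j ≤ ν j ∧ ν j ≤ C₁ * b j}

/-- The benchmark signals: non-zero elements of the ellipsoid. -/
def benchmarks (a : ℕ+ → ℝ) : Set EllTwo := {θ₀ | θ₀ ∈ ellipsoid a ∧ θ₀ ≠ 0}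

/-- A goodness-of-fit testing procedure: for each benchmark `θ₀` a non-randomized decision about
`H₀ : θ = θ₀`, as a function of the observations (`true` means that `H₀` is rejected). -/
abbrev Procedure : Type := EllTwo → Obs → Bool

/-- `Ψ` is a measurable procedure of level `α`, whatever the benchmark and whatever the singular
values in the class `B`. -/
def IsLevelTest (a : ℕ+ → ℝ) (B : Set (ℕ+ → ℝ)) (α ε σ : ℝ) (Ψ : Procedure) : Prop :=
  (∀ θ₀, Measurable (Ψ θ₀)) ∧
    ∀ θ₀ ∈ benchmarks a, ∀ ν ∈ B, law ε σ θ₀ ν {z | Ψ θ₀ z = true} ≤ ENNReal.ofReal α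

/-- The maximal second kind error probability of `Ψ` at radius `r`. -/
def secondKind (a : ℕ+ → ℝ) (B : Set (ℕ+ → ℝ)) (ε σ : ℝ) (Ψ : Procedure) (r : ℝ) : ℝ≥0∞ :=
  ⨆ θ₀ ∈ benchmarks a, ⨆ (θ : EllTwo) (_ : θ - θ₀ ∈ alternatives a r), ⨆ ν ∈ B,
    law ε σ θ ν {z | Ψ θ₀ z = false}

/-- The separation radius of `Ψ`. -/
def separationRadius (a : ℕ+ → ℝ) (B : Set (ℕ+ → ℝ)) (β ε σ : ℝ) (Ψ : Procedure) : ℝ≥0∞ :=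
  ⨅ (r : ℝ) (_ : 0 < r ∧ secondKind a B ε σ Ψ r ≤ ENNReal.ofReal β), ENNReal.ofReal r

/-- The minimax separation radius over the ellipsoid and the class `B` of singular values. -/
def minimaxRadius (a : ℕ+ → ℝ) (B : Set (ℕ+ → ℝ)) (α β ε σ : ℝ) : ℝ≥0∞ :=
  ⨅ (Ψ : Procedure) (_ : IsLevelTest a B α ε σ Ψ), separationRadius a B β ε σ Ψ

/-- `κ = 5 (3 π² + 12) / 6`. -/
def kappa : ℝ := 5 * (3 * Real.pi ^ 2 + 12) / 6

/-- `h_{0,j}`. -/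
def hZero (α : ℝ) (j : ℕ+) : ℝ :=
  18 * √(Real.log (kappa * (j : ℝ) ^ 2 / α)) + √(2 * Real.log (10 / α))

/-- `h_{1,j}`. -/
def hOne (α : ℝ) (j : ℕ+) : ℝ := 16 * √(Real.log (kappa * (j : ℝ) ^ 2 / α))

/-- `M₀ = inf {j ≥ 1 : b_j ≤ σ h_{0,j}} - 1` (infinite if there is no such `j`). -/
def bandM₀ (α σ : ℝ) (b : ℕ+ → ℝ) : ℕ∞ :=
  (⨅ (j : ℕ+) (_ : b j ≤ σ * hZero α j), ((j : ℕ) : ℕ∞)) - 1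

/-- `M₁ = inf {j ≥ 1 : b_j ≤ σ h_{1,j}}` (infinite if there is no such `j`). -/
def bandM₁ (α σ : ℝ) (b : ℕ+ → ℝ) : ℕ∞ :=
  ⨅ (j : ℕ+) (_ : b j ≤ σ * hOne α j), ((j : ℕ) : ℕ∞)

/-- `C_{α,β} = ln (1 + 4 (1 - α - β)²)`. -/
def bigC (α β : ℝ) : ℝ := Real.log (1 + 4 * (1 - α - β) ^ 2)

/-- `c_{α,β} = (2 ln (1 + 4 (1 - α - β)²))^{1/2}`. -/
def smallC (α β : ℝ) : ℝ := √(2 * Real.log (1 + 4 * (1 - α - β) ^ 2))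

/-- `C̃ = 16 C₀⁻² (3 √x_{α/2} + 2 x_{α/2} + 3 √x_{β/2})` with `x_γ = ln (1/γ)`. -/
def tildeC (α β C₀ : ℝ) : ℝ :=
  16 * (3 * √(Real.log (2 / α)) + 2 * Real.log (2 / α) + 3 * √(Real.log (2 / β))) / C₀ ^ 2

/-- `G_D(C₀, C₁)`: the mass that the Gaussian law with mean `b_D` and variance `σ²` gives to
`[C₀ b_D, C₁ b_D]`. -/
def gaussMass (C₀ C₁ σ : ℝ) (b : ℕ+ → ℝ) (D : ℕ+) : ℝ :=
  1 / (σ * √(2 * Real.pi)) *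
    ∫ t in (C₀ * b D)..(C₁ * b D), Real.exp (-(1 / (2 * σ ^ 2)) * (t - b D) ^ 2)

/-- `M₂ = sup {D ≥ 1 : C_{α,β} σ b_D⁻¹ ≤ 2 and G_D(C₀, C₁) ≥ (1 + 4 (1 - α - β)²)^{-1/2}}`
(zero if there is no such `D`). -/
def bandM₂ (α β C₀ C₁ σ : ℝ) (b : ℕ+ → ℝ) : ℕ∞ :=
  ⨆ (D : ℕ+) (_ : bigC α β * σ * (b D)⁻¹ ≤ 2 ∧
    1 / √(1 + 4 * (1 - α - β) ^ 2) ≤ gaussMass C₀ C₁ σ b D), ((D : ℕ) : ℕ∞)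

/-- `a_n⁻²`, with the convention `a_0⁻² = ∞`. -/
def invSq (a : ℕ+ → ℝ) (n : ℕ) : ℝ≥0∞ :=
  if h : 0 < n then ENNReal.ofReal ((a ⟨n, h⟩ ^ 2)⁻¹) else ⊤

/-- The bracket of the upper bound, for a given cut-off `D`. -/
def upperTerm (a b : ℕ+ → ℝ) (α β C₀ ε σ : ℝ) (D : ℕ+) : ℝ≥0∞ :=
  ENNReal.ofReal (tildeC α β C₀ * ε ^ 2 *
      √(∑ j ∈ (Finset.Icc 1 D).filter (fun j : ℕ+ => ((j : ℕ) : ℕ∞) ≤ bandM₁ α σ b),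
        (b j ^ 4)⁻¹)) +
    ENNReal.ofReal (7 + 4 * √(Real.log (2 / α))) *
      max (ENNReal.ofReal (σ ^ 2 * Real.log (1 / σ) ^ (3 / 2 : ℝ)))
        (invSq a (min ((D : ℕ) : ℕ∞) (bandM₀ α σ b)).toNat)

/-- The part of the lower bound that is due to the noise on the singular values. -/
def lowerSigma (a b : ℕ+ → ℝ) (α β C₀ C₁ σ : ℝ) : ℝ≥0∞ :=
  ⨆ (D : ℕ+) (_ : ((D : ℕ) : ℕ∞) ≤ bandM₂ α β C₀ C₁ σ b),
    ENNReal.ofReal (bigC α β ^ 2 / 16 * σ ^ 2 * ((b D ^ 2)⁻¹ * (a D ^ 2)⁻¹))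

/-- The part of the lower bound that is due to the noise on the signal. -/
def lowerEps (a b : ℕ+ → ℝ) (α β ε : ℝ) : ℝ≥0∞ :=
  ⨆ D : ℕ+, ENNReal.ofReal
    (min (smallC α β * ε ^ 2 * √(∑ j ∈ Finset.Icc 1 D, (b j ^ 4)⁻¹)) (a D ^ 2)⁻¹)

/-- The sequence `(a_j b_j)⁻¹` is bounded or non-decreasing, up to constants:
`(a_j b_j)⁻¹ ≤ K max(1, (a_k b_k)⁻¹)` for all `j ≤ k`. -/
def BoundedOrAlmostMonotone (a b : ℕ+ → ℝ) : Prop :=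
  ∃ K : ℝ, ∀ j k : ℕ+, j ≤ k → (a j * b j)⁻¹ ≤ K * max 1 (a k * b k)⁻¹

end GoF

end

/-!
**Upper bound.** The residuals `Y_j - θ₀_j X_j` (`Y_j - b_j θ₀_j` if `ν = b` is known) are
independent, Gaussian, with mean `ν_j (θ_j - θ₀_j)` and variance `ε² + τ² θ₀_j²`, where `τ = σ`
(`τ = 0`). The test rejects for large values of the sum over `j ≤ N` of their centred squares,
weighted by `b_j⁻²`; exponential moments of a squared Gaussian variable bound both errors. The part
of the noise level that comes from `τ` is at most `σ² max_{j ≤ N} (a_j b_j)⁻²`, as `θ₀ ∈ E_a`. By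
almost monotonicity only `(a_N b_N)⁻¹` matters, and `σ h_{0,N} < b_N` turns it into `a_N⁻²`, since
`h_{0,N} → ∞`; the finitely many remaining `N` are absorbed by the logarithm.

**Lower bound.** If some test of level `α` has second kind error at most `β` between two hypotheses,
then their likelihood ratio has second moment at least `1 + 4 (1 - α - β)²`. For the term in `σ`,
move `ν_D` and `θ_D` with `ν_D θ_D` fixed, so that only the law of `X_D` changes. For the term in
`ε`, average over random signs of `θ_j - θ₀_j ∝ ± b_j⁻²` and use `cosh x ≤ exp (x² / 2)`.
-/

namespace GoF

section ProductMeasures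

variable {ι : Type*} {X : ι → Type*} [∀ i, MeasurableSpace (X i)]

theorem lintegral_infinitePi_prod (μ : ∀ i, Measure (X i)) [∀ i, IsProbabilityMeasure (μ i)]
    (s : Finset ι) {f : ∀ i, X i → ℝ≥0∞} (hf : ∀ i, Measurable (f i)) :
    ∫⁻ z, ∏ i ∈ s, f i (z i) ∂(Measure.infinitePi μ) = ∏ i ∈ s, ∫⁻ x, f i x ∂(μ i) := by
  rw [lintegral_prod_eq_prod_lintegral_of_indepFun s _ (iIndepFun_infinitePi hf)
    fun i => (hf i).comp (measurable_pi_apply i)]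
  exact Finset.prod_congr rfl fun i _ =>
    (measurePreserving_eval_infinitePi μ i).lintegral_comp (hf i)

theorem setLIntegral_infinitePi_prod (μ : ∀ i, Measure (X i)) [∀ i, IsProbabilityMeasure (μ i)]
    (s : Finset ι) {f : ∀ i, X i → ℝ≥0∞} (hf : ∀ i, Measurable (f i))
    {t : ∀ i, Set (X i)} (ht : ∀ i, MeasurableSet (t i)) :
    ∫⁻ z in Set.pi s t, ∏ i ∈ s, f i (z i) ∂(Measure.infinitePi μ) =
      ∏ i ∈ s, ∫⁻ x in t i, f i x ∂(μ i) := by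
  have hindicator : ∀ z, (Set.pi s t).indicator (fun z => ∏ i ∈ s, f i (z i)) z =
      ∏ i ∈ s, (t i).indicator (f i) (z i) := by
    intro z
    by_cases hz : z ∈ Set.pi s t
    · rw [Set.indicator_of_mem hz]
      exact Finset.prod_congr rfl fun i hi => (Set.indicator_of_mem (hz i hi) _).symm
    · rw [Set.indicator_of_notMem hz]
      simp only [Set.mem_pi, not_forall] at hz
      obtain ⟨i, hi, hzi⟩ := hz
      exact (Finset.prod_eq_zero hi (Set.indicator_of_notMem hzi _)).symm
  rw [← lintegral_indicator (MeasurableSet.pi s.countable_toSet fun i _ => ht i),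
    lintegral_congr hindicator,
    lintegral_infinitePi_prod μ s fun i => (hf i).indicator (ht i)]
  exact Finset.prod_congr rfl fun i _ => lintegral_indicator (ht i) _

theorem infinitePi_eq_withDensity {μ μ' : ∀ i, Measure (X i)} [∀ i, IsProbabilityMeasure (μ i)]
    [∀ i, IsProbabilityMeasure (μ' i)] {f : ∀ i, X i → ℝ≥0∞} (hf : ∀ i, Measurable (f i))
    (hμ' : ∀ i, μ' i = (μ i).withDensity (f i)) {S : Finset ι} (hS : ∀ i ∉ S, f i = 1) :
    Measure.infinitePi μ' =
      (Measure.infinitePi μ).withDensity fun z => ∏ i ∈ S, f i (z i) := by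
  classical
  refine (Measure.eq_infinitePi μ' fun s t ht => ?_).symm
  let t' : ∀ i, Set (X i) := fun i => if i ∈ s then t i else Set.univ
  have ht' : ∀ i, MeasurableSet (t' i) := fun i => by
    by_cases hi : i ∈ s <;> simp [t', hi, ht i]
  have hbox : Set.pi (s : Set ι) t = Set.pi ((s ∪ S : Finset ι) : Set ι) t' := by
    ext z
    simp only [Set.mem_pi, Finset.mem_coe, Finset.mem_union, t']
    refine ⟨fun hz i _ => ?_, fun hz i hi => by simpa [hi] using hz i (Or.inl hi)⟩
    split_ifs with hi
    exacts [hz i hi, Set.mem_univ _]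
  have hdensity : ∀ z : ∀ i, X i, ∏ i ∈ S, f i (z i) = ∏ i ∈ s ∪ S, f i (z i) := fun z =>
    Finset.prod_subset Finset.subset_union_right fun i _ hi => by rw [hS i hi, Pi.one_apply]
  calc (Measure.infinitePi μ).withDensity (fun z => ∏ i ∈ S, f i (z i)) (Set.pi s t)
      = ∫⁻ z in Set.pi ((s ∪ S : Finset ι) : Set ι) t', ∏ i ∈ s ∪ S, f i (z i)
          ∂(Measure.infinitePi μ) := by
        rw [withDensity_apply _ (MeasurableSet.pi s.countable_toSet fun i _ => ht i), hbox]
        simp only [hdensity]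
    _ = ∏ i ∈ s ∪ S, μ' i (t' i) := by
        rw [setLIntegral_infinitePi_prod μ _ hf ht']
        exact Finset.prod_congr rfl fun i _ => by rw [hμ' i, withDensity_apply _ (ht' i)]
    _ = ∏ i ∈ s, μ' i (t' i) :=
        (Finset.prod_subset Finset.subset_union_left fun i _ hi => by simp [t', hi]).symm
    _ = ∏ i ∈ s, μ' i (t i) := Finset.prod_congr rfl fun i hi => by simp [t', hi]

end ProductMeasures

section ChiSquareBound

variable {Ω : Type*} [MeasurableSpace Ω]

theorem lintegral_eq_one_of_isProbabilityMeasure_withDensity {P : Measure Ω} {f : Ω → ℝ≥0∞}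
    [IsProbabilityMeasure (P.withDensity f)] : ∫⁻ z, f z ∂P = 1 := by
  rw [← setLIntegral_univ, ← withDensity_apply _ MeasurableSet.univ, measure_univ]

-- Since `∫ (1 - f) ∂P = 0`, the indicator of `A` may be recentred by `1 / 2`, which gains the
-- factor `4` over a direct application of Cauchy-Schwarz.
theorem one_add_four_mul_sub_sq_le_integral_sq {P : Measure Ω} [IsProbabilityMeasure P]
    {f : Ω → ℝ} (hf : MemLp f 2 P) (hone : ∫ z, f z ∂P = 1) {A : Set Ω} (hA : MeasurableSet A) :
    1 + 4 * (P.real A - ∫ z in A, f z ∂P) ^ 2 ≤ ∫ z, f z ^ 2 ∂P := by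
  have hf1 : Integrable f P := hf.integrable one_le_two
  have hdev : Integrable (fun z => 1 - f z) P := (integrable_const 1).sub hf1
  let X : Ω → ℝ := fun z => A.indicator (fun z => 1 - f z) z - 1 / 2 * (1 - f z)
  have hXsq : ∀ z, X z ^ 2 = 4⁻¹ * (1 - 2 * f z + f z ^ 2) := by
    intro z
    by_cases hz : z ∈ A <;> simp only [X, hz, Set.indicator_of_mem, Set.indicator_of_notMem,
      not_false_eq_true] <;> ring
  have hXmem : MemLp X 2 P :=
    (((memLp_const 1).sub hf).indicator hA).sub (((memLp_const 1).sub hf).const_mul (1 / 2))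
  have hXint : ∫ z, X z ∂P = P.real A - ∫ z in A, f z ∂P := by
    rw [integral_sub (hdev.indicator hA) (hdev.const_mul _), integral_indicator hA,
      integral_sub (integrable_const 1).integrableOn hf1.integrableOn, integral_const_mul,
      integral_sub (integrable_const 1) hf1, hone]
    simp
  have hXsqint : ∫ z, X z ^ 2 ∂P = 4⁻¹ * (∫ z, f z ^ 2 ∂P - 1) := by
    simp only [hXsq]
    have hlinear : Integrable (fun z => 1 - 2 * f z) P :=
      (integrable_const 1).sub (hf1.const_mul 2)
    rw [integral_const_mul, integral_add hlinear hf.integrable_sq,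
      integral_sub (integrable_const 1) (hf1.const_mul 2), integral_const_mul, hone]
    simp only [integral_const, probReal_univ, smul_eq_mul]
    ring
  have hvar := variance_nonneg X P
  rw [variance_eq_sub hXmem] at hvar
  simp only [Pi.pow_apply] at hvar
  rw [hXint, hXsqint] at hvar
  linarith

theorem ofReal_one_add_four_mul_sub_sq_le_lintegral_sq {P : Measure Ω} [IsProbabilityMeasure P]
    {f : Ω → ℝ≥0∞} (hf : Measurable f) [IsProbabilityMeasure (P.withDensity f)] {A : Set Ω}
    (hA : MeasurableSet A) :
    ENNReal.ofReal (1 + 4 * (P.real A - (P.withDensity f).real A) ^ 2) ≤ ∫⁻ z, f z ^ 2 ∂P := by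
  rcases eq_or_ne (∫⁻ z, f z ^ 2 ∂P) ⊤ with htop | htop
  · exact htop ▸ le_top
  have hone : ∫⁻ z, f z ∂P = 1 := lintegral_eq_one_of_isProbabilityMeasure_withDensity
  have hfin : ∀ᵐ z ∂P, f z < ⊤ := ae_lt_top hf (by simp [hone])
  have hsq_fin : ∀ᵐ z ∂P, f z ^ 2 < ⊤ := hfin.mono fun z hz => ENNReal.pow_lt_top hz
  have hint_sq : ∫ z, (f z).toReal ^ 2 ∂P = (∫⁻ z, f z ^ 2 ∂P).toReal := by
    rw [← integral_toReal (hf.pow_const 2).aemeasurable hsq_fin]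
    simp only [ENNReal.toReal_pow]
  have hmem : MemLp (fun z => (f z).toReal) 2 P := by
    rw [memLp_two_iff_integrable_sq hf.ennreal_toReal.aestronglyMeasurable]
    simpa only [ENNReal.toReal_pow] using
      integrable_toReal_of_lintegral_ne_top (hf.pow_const 2).aemeasurable htop
  have hintegral : ∫ z, (f z).toReal ∂P = 1 := by
    rw [integral_toReal hf.aemeasurable hfin, hone, ENNReal.toReal_one]
  have hmass : (P.withDensity f).real A = ∫ z in A, (f z).toReal ∂P := by
    rw [integral_toReal hf.aemeasurable (ae_restrict_of_ae hfin), measureReal_def,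
      withDensity_apply _ hA]
  rw [← ENNReal.ofReal_toReal htop, hmass, ← hint_sq]
  exact ENNReal.ofReal_le_ofReal (one_add_four_mul_sub_sq_le_integral_sq hmem hintegral hA)

theorem withDensity_prod_average_apply_le {ι : Type*} [DecidableEq ι] {P : Measure Ω}
    [SFinite P] {S : Finset ι} {f g : ι → Ω → ℝ≥0∞} (hf : ∀ i, Measurable (f i))
    (hg : ∀ i, Measurable (g i)) {A : Set Ω} {c : ℝ≥0∞}
    (h : ∀ t : Finset ι,
      (P.withDensity fun z => ∏ i ∈ S, if i ∈ t then f i z else g i z) A ≤ c) :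
    (P.withDensity fun z => ∏ i ∈ S, 2⁻¹ * (f i z + g i z)) A ≤ c := by
  have hexpand : ∀ z, ∏ i ∈ S, 2⁻¹ * (f i z + g i z) =
      2⁻¹ ^ S.card * ∑ t ∈ S.powerset, ∏ i ∈ S, if i ∈ t then f i z else g i z := by
    intro z
    rw [Finset.prod_mul_distrib, Finset.prod_const, Finset.prod_add]
    congr 1
    refine Finset.sum_congr rfl fun t ht => ?_
    rw [Finset.prod_ite, Finset.filter_mem_eq_inter, Finset.filter_notMem_eq_sdiff,
      Finset.inter_eq_right.2 (Finset.mem_powerset.1 ht)]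
  have hmeas : ∀ t : Finset ι, Measurable fun z => ∏ i ∈ S, if i ∈ t then f i z else g i z :=
    fun t => Finset.measurable_fun_prod _ fun i _ => by split_ifs; exacts [hf i, hg i]
  calc (P.withDensity fun z => ∏ i ∈ S, 2⁻¹ * (f i z + g i z)) A
      = 2⁻¹ ^ S.card * ∑ t ∈ S.powerset,
          (P.withDensity fun z => ∏ i ∈ S, if i ∈ t then f i z else g i z) A := by
        simp only [withDensity_apply', hexpand]
        rw [lintegral_const_mul _ (Finset.measurable_fun_sum _ fun t _ => hmeas t),
          lintegral_finsetSum _ fun t _ => hmeas t]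
    _ ≤ 2⁻¹ ^ S.card * ∑ _t ∈ S.powerset, c := by gcongr; exact h _
    _ = c := by
        rw [Finset.sum_const, Finset.card_powerset, nsmul_eq_mul, ← mul_assoc, Nat.cast_pow,
          Nat.cast_ofNat, ← mul_pow,
          ENNReal.inv_mul_cancel two_ne_zero ENNReal.ofNat_ne_top, one_pow, one_mul]

end ChiSquareBound

section GaussianIntegrals

theorem gaussianPDFReal_mul_exp_neg_sq (m c : ℝ) (v : ℝ≥0) (hc : 0 < 1 + 2 * c * v) (x : ℝ) :
    gaussianPDFReal m v x * Real.exp (-c * x ^ 2) =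
      ((√(1 + 2 * c * v))⁻¹ * Real.exp (-c * m ^ 2 / (1 + 2 * c * v))) *
        gaussianPDFReal (m / (1 + 2 * c * v)) (v / (1 + 2 * c * v).toNNReal) x := by
  rcases eq_or_ne v 0 with rfl | hv
  · simp
  have : (0 : ℝ) < v := NNReal.coe_pos.2 (pos_iff_ne_zero.2 hv)
  simp only [gaussianPDFReal_def, NNReal.coe_div, Real.coe_toNNReal _ hc.le]
  set q := 1 + 2 * c * (v : ℝ) with hq
  have hsqrt : √(2 * Real.pi * (v / q)) = √(2 * Real.pi * v) / √q := by
    rw [← mul_div_assoc, Real.sqrt_div' _ hc.le]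
  have hq0 : √q ≠ 0 := (Real.sqrt_pos.2 hc).ne'
  have hsquare : -(x - m) ^ 2 / (2 * v) + -c * x ^ 2 =
      -c * m ^ 2 / q + -(x - m / q) ^ 2 / (2 * (v / q)) := by
    field_simp
    rw [hq]
    ring
  rw [mul_assoc, ← Real.exp_add, hsquare, Real.exp_add, hsqrt]
  field_simp

theorem lintegral_exp_neg_sq_gaussianReal (m c : ℝ) {v : ℝ≥0} (hv : v ≠ 0)
    (hc : 0 < 1 + 2 * c * v) :
    ∫⁻ x, ENNReal.ofReal (Real.exp (-c * x ^ 2)) ∂(gaussianReal m v) =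
      ENNReal.ofReal ((√(1 + 2 * c * v))⁻¹ * Real.exp (-c * m ^ 2 / (1 + 2 * c * v))) := by
  have hv' : v / (1 + 2 * c * v).toNNReal ≠ 0 := div_ne_zero hv (by simpa using hc)
  have hpoint : ∀ x, (gaussianPDF m v * fun x => ENNReal.ofReal (Real.exp (-c * x ^ 2))) x =
      ENNReal.ofReal ((√(1 + 2 * c * v))⁻¹ * Real.exp (-c * m ^ 2 / (1 + 2 * c * v))) *
        gaussianPDF (m / (1 + 2 * c * v)) (v / (1 + 2 * c * v).toNNReal) x := by
    intro x
    rw [Pi.mul_apply, gaussianPDF, gaussianPDF,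
      ← ENNReal.ofReal_mul (gaussianPDFReal_nonneg _ _ _), ← ENNReal.ofReal_mul (by positivity),
      gaussianPDFReal_mul_exp_neg_sq m c v hc]
  rw [gaussianReal_of_var_ne_zero _ hv, lintegral_withDensity_eq_lintegral_mul _
    (measurable_gaussianPDF m v) (by fun_prop), lintegral_congr hpoint,
    lintegral_const_mul _ (measurable_gaussianPDF _ _), lintegral_gaussianPDF_eq_one _ hv', mul_one]

theorem inv_sqrt_one_sub_two_mul_le {u : ℝ} (h0 : 0 ≤ u) (h1 : u ≤ 1 / 4) :
    (√(1 - 2 * u))⁻¹ ≤ Real.exp (u + 2 * u ^ 2) := by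
  have hpos : 0 < 1 - 2 * u := by linarith
  have hquadratic := Real.quadratic_le_exp_of_nonneg (x := 2 * u + 4 * u ^ 2) (by positivity)
  have hone : 1 ≤ (1 - 2 * u) * Real.exp (2 * u + 4 * u ^ 2) := by
    refine le_trans ?_ (mul_le_mul_of_nonneg_left hquadratic hpos.le)
    have hfactor : (1 - 2 * u) * (1 + (2 * u + 4 * u ^ 2) + (2 * u + 4 * u ^ 2) ^ 2 / 2) - 1 =
        2 * u ^ 2 * (1 - 2 * u - 4 * u ^ 2 - 8 * u ^ 3) := by ring
    have hsq : u ^ 2 ≤ 1 / 16 := by nlinarith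
    have hcube : u ^ 3 ≤ 1 / 64 := by nlinarith
    have : 0 ≤ 2 * u ^ 2 * (1 - 2 * u - 4 * u ^ 2 - 8 * u ^ 3) :=
      mul_nonneg (by positivity) (by linarith)
    linarith [hfactor]
  have hsqrt : Real.exp (u + 2 * u ^ 2) = √(Real.exp (2 * u + 4 * u ^ 2)) := by
    rw [← Real.exp_half]
    ring_nf
  rw [inv_le_iff_one_le_mul₀ (Real.sqrt_pos.2 hpos), mul_comm, hsqrt, ← Real.sqrt_mul hpos.le]
  exact Real.one_le_sqrt.2 hone

theorem inv_sqrt_one_add_two_mul_le {u : ℝ} (h0 : 0 ≤ u) :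
    (√(1 + 2 * u))⁻¹ ≤ Real.exp (-u + u ^ 2) := by
  have hpos : 0 < 1 + 2 * u := by linarith
  have hlog : 2 * u - 2 * u ^ 2 ≤ Real.log (1 + 2 * u) := by
    refine le_trans ?_ (Real.le_log_one_add_of_nonneg (x := 2 * u) (by linarith))
    rw [le_div_iff₀ (by linarith)]
    nlinarith [pow_nonneg h0 3]
  have hsqrt : (√(1 + 2 * u))⁻¹ = Real.exp (-(Real.log (1 + 2 * u) / 2)) := by
    rw [Real.exp_neg, Real.exp_half, Real.exp_log hpos]
  rw [hsqrt, Real.exp_le_exp]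
  linarith

theorem lintegral_exp_sq_sub_var_le {t : ℝ} {v : ℝ≥0} (hv : v ≠ 0) (ht : 0 ≤ t)
    (htv : t * v ≤ 1 / 4) :
    ∫⁻ x, ENNReal.ofReal (Real.exp (t * (x ^ 2 - v))) ∂(gaussianReal 0 v) ≤
      ENNReal.ofReal (Real.exp (2 * (t * v) ^ 2)) := by
  have hc : 0 < 1 + 2 * (-t) * (v : ℝ) := by linarith
  have hpoint : ∀ x : ℝ, ENNReal.ofReal (Real.exp (t * (x ^ 2 - v))) =
      ENNReal.ofReal (Real.exp (-(t * v))) * ENNReal.ofReal (Real.exp (-(-t) * x ^ 2)) := by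
    intro x
    rw [← ENNReal.ofReal_mul (Real.exp_nonneg _), ← Real.exp_add]
    ring_nf
  rw [lintegral_congr hpoint, lintegral_const_mul _ (by fun_prop),
    lintegral_exp_neg_sq_gaussianReal 0 (-t) hv hc, ← ENNReal.ofReal_mul (Real.exp_nonneg _)]
  refine ENNReal.ofReal_le_ofReal ?_
  calc Real.exp (-(t * v)) *
        ((√(1 + 2 * (-t) * v))⁻¹ * Real.exp (-(-t) * 0 ^ 2 / (1 + 2 * (-t) * v)))
      = Real.exp (-(t * v)) * (√(1 - 2 * (t * v)))⁻¹ := by simp [sub_eq_add_neg, mul_assoc]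
    _ ≤ Real.exp (-(t * v)) * Real.exp (t * v + 2 * (t * v) ^ 2) := by
        gcongr
        exact inv_sqrt_one_sub_two_mul_le (mul_nonneg ht v.coe_nonneg) htv
    _ = Real.exp (2 * (t * v) ^ 2) := by rw [← Real.exp_add]; ring_nf

theorem lintegral_exp_neg_sq_sub_var_le (m : ℝ) {t : ℝ} {v : ℝ≥0} (hv : v ≠ 0) (ht : 0 ≤ t)
    (htv : t * v ≤ 1 / 4) :
    ∫⁻ x, ENNReal.ofReal (Real.exp (-(t * (x ^ 2 - v)))) ∂(gaussianReal m v) ≤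
      ENNReal.ofReal (Real.exp ((t * v) ^ 2 - 2 / 3 * (t * m ^ 2))) := by
  have htv0 : 0 ≤ t * v := mul_nonneg ht v.coe_nonneg
  have hc : 0 < 1 + 2 * t * (v : ℝ) := by linarith
  have hpoint : ∀ x : ℝ, ENNReal.ofReal (Real.exp (-(t * (x ^ 2 - v)))) =
      ENNReal.ofReal (Real.exp (t * v)) * ENNReal.ofReal (Real.exp (-t * x ^ 2)) := by
    intro x
    rw [← ENNReal.ofReal_mul (Real.exp_nonneg _), ← Real.exp_add]
    ring_nf
  have hmean : -t * m ^ 2 / (1 + 2 * t * v) ≤ -(2 / 3 * (t * m ^ 2)) := by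
    rw [neg_mul, neg_div, neg_le_neg_iff, le_div_iff₀ hc]
    nlinarith [mul_nonneg ht (sq_nonneg m)]
  rw [lintegral_congr hpoint, lintegral_const_mul _ (by fun_prop),
    lintegral_exp_neg_sq_gaussianReal m t hv hc, ← ENNReal.ofReal_mul (Real.exp_nonneg _)]
  refine ENNReal.ofReal_le_ofReal ?_
  calc Real.exp (t * v) * ((√(1 + 2 * t * v))⁻¹ * Real.exp (-t * m ^ 2 / (1 + 2 * t * v)))
      ≤ Real.exp (t * v) *
          (Real.exp (-(t * v) + (t * v) ^ 2) * Real.exp (-(2 / 3 * (t * m ^ 2)))) := by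
        gcongr
        rw [mul_assoc]
        exact inv_sqrt_one_add_two_mul_le htv0
    _ = Real.exp ((t * v) ^ 2 - 2 / 3 * (t * m ^ 2)) := by
        rw [← Real.exp_add, ← Real.exp_add]
        ring_nf

/-- The likelihood ratio of `N(m + d, v)` with respect to `N(m, v)`. -/
noncomputable def shiftDensity (m d : ℝ) (v : ℝ≥0) (x : ℝ) : ℝ≥0∞ :=
  ENNReal.ofReal (Real.exp (d * (x - m) / v - d ^ 2 / (2 * v)))

@[fun_prop]
theorem measurable_shiftDensity (m d : ℝ) (v : ℝ≥0) : Measurable (shiftDensity m d v) := by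
  unfold shiftDensity
  fun_prop

theorem shiftDensity_zero (m : ℝ) (v : ℝ≥0) : shiftDensity m 0 v = 1 := by
  ext x
  simp [shiftDensity]

theorem gaussianReal_add_eq_withDensity (m d : ℝ) {v : ℝ≥0} (hv : v ≠ 0) :
    gaussianReal (m + d) v = (gaussianReal m v).withDensity (shiftDensity m d v) := by
  have hv' : (v : ℝ) ≠ 0 := NNReal.coe_ne_zero.2 hv
  rw [gaussianReal_of_var_ne_zero _ hv, gaussianReal_of_var_ne_zero _ hv,
    ← withDensity_mul _ (measurable_gaussianPDF m v) (measurable_shiftDensity m d v)]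
  congr 1
  ext x
  rw [Pi.mul_apply, gaussianPDF, gaussianPDF, shiftDensity,
    ← ENNReal.ofReal_mul (gaussianPDFReal_nonneg _ _ _), gaussianPDFReal, gaussianPDFReal,
    mul_assoc (√(2 * Real.pi * v))⁻¹, ← Real.exp_add]
  congr 3
  field_simp
  ring

theorem lintegral_shiftDensity_mul (m d d' : ℝ) {v : ℝ≥0} (hv : v ≠ 0) :
    ∫⁻ x, shiftDensity m d v x * shiftDensity m d' v x ∂(gaussianReal m v) =
      ENNReal.ofReal (Real.exp (d * d' / v)) := by
  have hv' : (v : ℝ) ≠ 0 := NNReal.coe_ne_zero.2 hv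
  have hpoint : ∀ x, shiftDensity m d v x * shiftDensity m d' v x =
      ENNReal.ofReal (Real.exp (d * d' / v)) * shiftDensity m (d + d') v x := by
    intro x
    simp only [shiftDensity]
    rw [← ENNReal.ofReal_mul (Real.exp_nonneg _), ← ENNReal.ofReal_mul (Real.exp_nonneg _),
      ← Real.exp_add, ← Real.exp_add]
    congr 2
    field_simp
    ring
  have : IsProbabilityMeasure ((gaussianReal m v).withDensity (shiftDensity m (d + d') v)) :=
    gaussianReal_add_eq_withDensity m (d + d') hv ▸ inferInstance
  rw [lintegral_congr hpoint, lintegral_const_mul _ (by fun_prop),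
    lintegral_eq_one_of_isProbabilityMeasure_withDensity, mul_one]

theorem lintegral_average_shiftDensity_sq (m d : ℝ) {v : ℝ≥0} (hv : v ≠ 0) :
    ∫⁻ x, (2⁻¹ * (shiftDensity m d v x + shiftDensity m (-d) v x)) ^ 2 ∂(gaussianReal m v) =
      ENNReal.ofReal (Real.cosh (d ^ 2 / v)) := by
  have hpoint : ∀ x, (2⁻¹ * (shiftDensity m d v x + shiftDensity m (-d) v x)) ^ 2 =
      2⁻¹ ^ 2 * (shiftDensity m d v x * shiftDensity m d v x +
        shiftDensity m (-d) v x * shiftDensity m (-d) v x +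
        2 * (shiftDensity m d v x * shiftDensity m (-d) v x)) := fun x => by ring
  have htwo : (2⁻¹ : ℝ≥0∞) ^ 2 = ENNReal.ofReal (1 / 4) := by
    rw [show (1 / 4 : ℝ) = 2⁻¹ ^ 2 by norm_num, ENNReal.ofReal_pow (by norm_num),
      ENNReal.ofReal_inv_of_pos two_pos, ENNReal.ofReal_ofNat]
  rw [lintegral_congr hpoint, lintegral_const_mul _ (by fun_prop),
    lintegral_add_left (by fun_prop), lintegral_add_left (by fun_prop),
    lintegral_const_mul _ (by fun_prop)]
  simp only [lintegral_shiftDensity_mul m _ _ hv]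
  rw [htwo, ← ENNReal.ofReal_ofNat 2, ← ENNReal.ofReal_mul two_pos.le,
    ← ENNReal.ofReal_add (by positivity) (by positivity),
    ← ENNReal.ofReal_add (by positivity) (by positivity), ← ENNReal.ofReal_mul (by norm_num),
    Real.cosh_eq]
  ring_nf

theorem gaussianReal_prod_map_sub_const_mul (m₁ m₂ c : ℝ) (v₁ v₂ : ℝ≥0) :
    ((gaussianReal m₁ v₁).prod (gaussianReal m₂ v₂)).map (fun p => p.1 - c * p.2) =
      gaussianReal (m₁ - c * m₂) (v₁ + (c ^ 2).toNNReal * v₂) := by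
  have hind : IndepFun (fun p : ℝ × ℝ => p.1) (fun p : ℝ × ℝ => -c * p.2)
      ((gaussianReal m₁ v₁).prod (gaussianReal m₂ v₂)) :=
    indepFun_prod (X := id) (Y := fun x => -c * x) measurable_id (by fun_prop)
  have hfst : ((gaussianReal m₁ v₁).prod (gaussianReal m₂ v₂)).map (fun p => p.1) =
      gaussianReal m₁ v₁ := by simp
  have hsnd : ((gaussianReal m₁ v₁).prod (gaussianReal m₂ v₂)).map (fun p => -c * p.2) =
      gaussianReal (-c * m₂) ((c ^ 2).toNNReal * v₂) := by
    have hmarginal : ((gaussianReal m₁ v₁).prod (gaussianReal m₂ v₂)).map Prod.snd =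
      gaussianReal m₂ v₂ := by simp
    rw [← Function.comp_def (fun x => -c * x) Prod.snd,
      ← Measure.map_map (by fun_prop) (by fun_prop), hmarginal, gaussianReal_map_const_mul]
    congr 2
    ext
    simp [Real.coe_toNNReal _ (sq_nonneg c)]
  have hsum := gaussianReal_add_gaussianReal_of_indepFun hind hfst hsnd
  simpa only [Pi.add_def, neg_mul, ← sub_eq_add_neg] using hsum

end GaussianIntegrals

section Sequences

theorem summable_sq (θ : EllTwo) : Summable fun j => θ j ^ 2 := by
  simpa using (lp.memℓp θ).summable (by norm_num)

theorem norm_sq_eq_tsum (θ : EllTwo) : ‖θ‖ ^ 2 = ∑' j, θ j ^ 2 := by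
  simpa using lp.norm_rpow_eq_tsum (p := 2) (by norm_num) θ

/-- The square-summable sequence that agrees with `δ` on `S` and vanishes elsewhere. -/
noncomputable def truncate (S : Finset ℕ+) (δ : ℕ+ → ℝ) : EllTwo :=
  ⟨fun j => if j ∈ S then δ j else 0, memℓp_gen <|
    summable_of_ne_finset_zero (s := S) fun j hj => by simp [hj]⟩

theorem truncate_apply (S : Finset ℕ+) (δ : ℕ+ → ℝ) (j : ℕ+) :
    truncate S δ j = if j ∈ S then δ j else 0 := rfl

theorem truncate_sub_truncate (S : Finset ℕ+) (δ δ' : ℕ+ → ℝ) :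
    truncate S δ - truncate S δ' = truncate S (δ - δ') := by
  ext j
  rw [lp.coeFn_sub, Pi.sub_apply, truncate_apply, truncate_apply, truncate_apply]
  split_ifs <;> simp

theorem norm_truncate_sq (S : Finset ℕ+) (δ : ℕ+ → ℝ) :
    ‖truncate S δ‖ ^ 2 = ∑ j ∈ S, δ j ^ 2 := by
  rw [norm_sq_eq_tsum, tsum_eq_sum (s := S) fun j hj => by simp [truncate_apply, hj]]
  exact Finset.sum_congr rfl fun j hj => by simp [truncate_apply, hj]

theorem truncate_mem_ellipsoid {a : ℕ+ → ℝ} {S : Finset ℕ+} {δ : ℕ+ → ℝ}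
    (h : ∑ j ∈ S, a j ^ 2 * δ j ^ 2 ≤ 1) : truncate S δ ∈ ellipsoid a := by
  have hzero : ∀ j ∉ S, a j ^ 2 * truncate S δ j ^ 2 = 0 := fun j hj => by
    simp [truncate_apply, hj]
  refine ⟨summable_of_ne_finset_zero hzero, ?_⟩
  rw [tsum_eq_sum hzero]
  refine le_of_eq_of_le (Finset.sum_congr rfl fun j hj => ?_) h
  simp [truncate_apply, hj]

theorem truncate_mem_alternatives {a : ℕ+ → ℝ} {S : Finset ℕ+} {δ : ℕ+ → ℝ} {r : ℝ}
    (h : ∑ j ∈ S, a j ^ 2 * δ j ^ 2 ≤ 1) (hr : r ^ 2 ≤ ∑ j ∈ S, δ j ^ 2) :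
    truncate S δ ∈ alternatives a r :=
  ⟨truncate_mem_ellipsoid h,
    (le_abs_self r).trans (abs_le_of_sq_le_sq (norm_truncate_sq S δ ▸ hr) (norm_nonneg _))⟩

theorem truncate_singleton_mem_benchmarks {a : ℕ+ → ℝ} {D : ℕ+} (ha : a D ≠ 0) :
    truncate {D} (fun j => (a j)⁻¹) ∈ benchmarks a := by
  refine ⟨truncate_mem_ellipsoid ?_, fun h => ?_⟩
  · rw [Finset.sum_singleton, ← mul_pow, mul_inv_cancel₀ ha, one_pow]
  · have hD : truncate {D} (fun j => (a j)⁻¹) D = 0 := by rw [h]; rfl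
    simp [truncate_apply, ha] at hD

end Sequences

section Likelihood

theorem toNNReal_sq_ne_zero {σ : ℝ} (hσ : 0 < σ) : (σ ^ 2).toNNReal ≠ 0 :=
  (Real.toNNReal_pos.2 (pow_pos hσ 2)).ne'

theorem coe_toNNReal_sq (σ : ℝ) : ((σ ^ 2).toNNReal : ℝ) = σ ^ 2 :=
  Real.coe_toNNReal _ (sq_nonneg σ)

/-- The law of a single observation `(Y_j, X_j)` with signal coordinate `x` and singular value
`y`. -/
noncomputable def coordLaw (ε σ x y : ℝ) : Measure (ℝ × ℝ) :=
  (gaussianReal (y * x) (ε ^ 2).toNNReal).prod (gaussianReal y (σ ^ 2).toNNReal)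

instance isProbabilityMeasure_coordLaw (ε σ x y : ℝ) :
    IsProbabilityMeasure (coordLaw ε σ x y) := by
  unfold coordLaw
  infer_instance

theorem law_eq_infinitePi (ε σ : ℝ) (θ : EllTwo) (ν : ℕ+ → ℝ) :
    law ε σ θ ν = Measure.infinitePi fun j => coordLaw ε σ (θ j) (ν j) := rfl

theorem coordLaw_add_eq_withDensity {ε : ℝ} (hε : 0 < ε) (σ x h y : ℝ) :
    coordLaw ε σ (x + h) y = (coordLaw ε σ x y).withDensity
      fun p => shiftDensity (y * x) (y * h) (ε ^ 2).toNNReal p.1 := by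
  rw [coordLaw, coordLaw, mul_add, gaussianReal_add_eq_withDensity _ _ (toNNReal_sq_ne_zero hε),
    prod_withDensity_left (by fun_prop)]

theorem coordLaw_eq_withDensity_of_mul_eq (ε : ℝ) {σ : ℝ} (hσ : 0 < σ) {x x' y y' : ℝ}
    (hmul : y' * x' = y * x) :
    coordLaw ε σ x' y' = (coordLaw ε σ x y).withDensity
      fun p => shiftDensity y (y' - y) (σ ^ 2).toNNReal p.2 := by
  rw [coordLaw, coordLaw, hmul, ← prod_withDensity_right (by fun_prop),
    ← gaussianReal_add_eq_withDensity _ _ (toNNReal_sq_ne_zero hσ), add_sub_cancel]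

instance isProbabilityMeasure_law (ε σ : ℝ) (θ : EllTwo) (ν : ℕ+ → ℝ) :
    IsProbabilityMeasure (law ε σ θ ν) := by
  rw [law_eq_infinitePi]
  infer_instance

theorem lintegral_law_prod_fst (ε σ : ℝ) (θ : EllTwo) (ν : ℕ+ → ℝ) (S : Finset ℕ+)
    {f : ℕ+ → ℝ → ℝ≥0∞} (hf : ∀ j, Measurable (f j)) :
    ∫⁻ z, ∏ j ∈ S, f j (z j).1 ∂(law ε σ θ ν) =
      ∏ j ∈ S, ∫⁻ x, f j x ∂(gaussianReal (ν j * θ j) (ε ^ 2).toNNReal) :=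
  (lintegral_infinitePi_prod (X := fun _ : ℕ+ => ℝ × ℝ) (f := fun j p => f j p.1)
    (fun j => coordLaw ε σ (θ j) (ν j)) S fun j => (hf j).comp measurable_fst).trans <|
  Finset.prod_congr rfl fun j _ => measurePreserving_fst.lintegral_comp (hf j)

theorem lintegral_law_prod_snd (ε σ : ℝ) (θ : EllTwo) (ν : ℕ+ → ℝ) (S : Finset ℕ+)
    {f : ℕ+ → ℝ → ℝ≥0∞} (hf : ∀ j, Measurable (f j)) :
    ∫⁻ z, ∏ j ∈ S, f j (z j).2 ∂(law ε σ θ ν) =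
      ∏ j ∈ S, ∫⁻ x, f j x ∂(gaussianReal (ν j) (σ ^ 2).toNNReal) :=
  (lintegral_infinitePi_prod (X := fun _ : ℕ+ => ℝ × ℝ) (f := fun j p => f j p.2)
    (fun j => coordLaw ε σ (θ j) (ν j)) S fun j => (hf j).comp measurable_snd).trans <|
  Finset.prod_congr rfl fun j _ => measurePreserving_snd.lintegral_comp (hf j)

theorem law_add_eq_withDensity {ε : ℝ} (hε : 0 < ε) (σ : ℝ) (θ h : EllTwo) (ν : ℕ+ → ℝ)
    {S : Finset ℕ+} (hS : ∀ j ∉ S, h j = 0) :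
    law ε σ (θ + h) ν = (law ε σ θ ν).withDensity fun z =>
      ∏ j ∈ S, shiftDensity (ν j * θ j) (ν j * h j) (ε ^ 2).toNNReal (z j).1 := by
  refine infinitePi_eq_withDensity (X := fun _ : ℕ+ => ℝ × ℝ)
    (μ := fun j => coordLaw ε σ (θ j) (ν j)) (μ' := fun j => coordLaw ε σ (θ j + h j) (ν j))
    (f := fun j p => shiftDensity (ν j * θ j) (ν j * h j) (ε ^ 2).toNNReal p.1)
    (fun j => (measurable_shiftDensity _ _ _).comp measurable_fst)
    (fun j => coordLaw_add_eq_withDensity hε σ (θ j) (h j) (ν j)) fun j hj => ?_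
  ext p
  simp only [hS j hj, mul_zero, shiftDensity_zero, Pi.one_apply]

theorem law_eq_withDensity_of_mul_eq (ε : ℝ) {σ : ℝ} (hσ : 0 < σ) {θ θ' : EllTwo}
    {ν ν' : ℕ+ → ℝ} (hmul : ∀ j, ν' j * θ' j = ν j * θ j) {S : Finset ℕ+}
    (hS : ∀ j ∉ S, ν' j = ν j) :
    law ε σ θ' ν' = (law ε σ θ ν).withDensity fun z =>
      ∏ j ∈ S, shiftDensity (ν j) (ν' j - ν j) (σ ^ 2).toNNReal (z j).2 := by
  refine infinitePi_eq_withDensity (X := fun _ : ℕ+ => ℝ × ℝ)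
    (μ := fun j => coordLaw ε σ (θ j) (ν j)) (μ' := fun j => coordLaw ε σ (θ' j) (ν' j))
    (f := fun j p => shiftDensity (ν j) (ν' j - ν j) (σ ^ 2).toNNReal p.2)
    (fun j => (measurable_shiftDensity _ _ _).comp measurable_snd)
    (fun j => coordLaw_eq_withDensity_of_mul_eq ε hσ (hmul j)) fun j hj => ?_
  ext p
  simp only [hS j hj, sub_self, shiftDensity_zero, Pi.one_apply]

end Likelihood

section TestingErrors

theorem bigC_pos {α β : ℝ} (h : α + β < 1) : 0 < bigC α β := by
  have : 0 < 1 - α - β := by linarith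
  exact Real.log_pos (lt_add_of_pos_right 1 (by positivity))

theorem bigC_le_two {α β : ℝ} (hα : 0 < α) (hβ : 0 < β) (h : α + β < 1) : bigC α β ≤ 2 := by
  have hfive : 1 + 4 * (1 - α - β) ^ 2 ≤ 5 := by nlinarith
  have hquadratic := Real.quadratic_le_exp_of_nonneg zero_le_two
  rw [bigC, Real.log_le_iff_le_exp (by positivity)]
  linarith

theorem bigC_le_of_lintegral_sq_le {Ω : Type*} [MeasurableSpace Ω] {P : Measure Ω}
    [IsProbabilityMeasure P] {f : Ω → ℝ≥0∞} (hf : Measurable f)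
    [IsProbabilityMeasure (P.withDensity f)] {T : Ω → Bool} (hT : Measurable T) {α β x : ℝ}
    (hα : 0 ≤ α) (hβ : 0 ≤ β) (hαβ : α + β ≤ 1) (h₀ : P {z | T z = true} ≤ ENNReal.ofReal α)
    (h₁ : (P.withDensity f) {z | T z = false} ≤ ENNReal.ofReal β)
    (hx : ∫⁻ z, f z ^ 2 ∂P ≤ ENNReal.ofReal (Real.exp x)) : bigC α β ≤ x := by
  have hA : MeasurableSet {z | T z = false} := hT (measurableSet_singleton false)
  have hcompl : {z | T z = true} = {z | T z = false}ᶜ := by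
    ext z
    simp
  have h₀' : P.real {z | T z = true} ≤ α := ENNReal.toReal_le_of_le_ofReal hα h₀
  have h₁' : (P.withDensity f).real {z | T z = false} ≤ β :=
    ENNReal.toReal_le_of_le_ofReal hβ h₁
  rw [hcompl, probReal_compl_eq_one_sub hA] at h₀'
  have hchi := (ofReal_one_add_four_mul_sub_sq_le_lintegral_sq (P := P) hf hA).trans hx
  rw [ENNReal.ofReal_le_ofReal_iff (Real.exp_nonneg x)] at hchi
  rw [bigC, Real.log_le_iff_le_exp (by positivity)]
  refine le_trans ?_ hchi
  gcongr 1 + 4 * ?_ ^ 2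
  · linarith
  · linarith

theorem bigC_le_sum_of_mul_eq {ε σ : ℝ} (hσ : 0 < σ) {θ θ' : EllTwo} {ν ν' : ℕ+ → ℝ}
    (hmul : ∀ j, ν' j * θ' j = ν j * θ j) {S : Finset ℕ+} (hS : ∀ j ∉ S, ν' j = ν j)
    {T : Obs → Bool} (hT : Measurable T) {α β : ℝ} (hα : 0 ≤ α) (hβ : 0 ≤ β) (hαβ : α + β ≤ 1)
    (h₀ : law ε σ θ ν {z | T z = true} ≤ ENNReal.ofReal α)
    (h₁ : law ε σ θ' ν' {z | T z = false} ≤ ENNReal.ofReal β) :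
    bigC α β ≤ ∑ j ∈ S, (ν' j - ν j) ^ 2 / σ ^ 2 := by
  have hdensity := law_eq_withDensity_of_mul_eq ε hσ hmul hS
  have hprob := isProbabilityMeasure_law ε σ θ' ν'
  rw [hdensity] at hprob h₁
  refine bigC_le_of_lintegral_sq_le (Finset.measurable_fun_prod _ fun j _ => by fun_prop) hT
    hα hβ hαβ h₀ h₁ (le_of_eq ?_)
  simp only [← Finset.prod_pow]
  rw [lintegral_law_prod_snd ε σ θ ν S fun j => (measurable_shiftDensity _ _ _).pow_const 2]
  have hsq : ∀ m d, ∫⁻ x, shiftDensity m d (σ ^ 2).toNNReal x ^ 2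
      ∂(gaussianReal m (σ ^ 2).toNNReal) = ENNReal.ofReal (Real.exp (d ^ 2 / σ ^ 2)) := by
    intro m d
    simpa only [← sq, coe_toNNReal_sq] using
      lintegral_shiftDensity_mul m d d (toNNReal_sq_ne_zero hσ)
  simp only [hsq]
  rw [← ENNReal.ofReal_prod_of_nonneg fun j _ => Real.exp_nonneg _, ← Real.exp_sum]

/-- The perturbation of a signal by `+ δ_j` at the coordinates `j ∈ S ∩ t` and by `- δ_j` at the
coordinates `j ∈ S \ t`: the finite set `t` encodes the choice of signs. -/
noncomputable def signPerturbation (S : Finset ℕ+) (δ : ℕ+ → ℝ) (t : Finset ℕ+) : EllTwo :=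
  truncate S fun j => if j ∈ t then δ j else -δ j

/-- The likelihood ratio, with respect to `law ε σ θ b`, of the uniform mixture over all `t ⊆ S` of
the laws `law ε σ (θ + signPerturbation S δ t) b`. It factorizes over the coordinates. -/
noncomputable def signMixtureDensity (ε : ℝ) (θ : EllTwo) (b δ : ℕ+ → ℝ) (S : Finset ℕ+)
    (z : Obs) : ℝ≥0∞ :=
  ∏ j ∈ S, 2⁻¹ * (shiftDensity (b j * θ j) (b j * δ j) (ε ^ 2).toNNReal (z j).1 +
    shiftDensity (b j * θ j) (-(b j * δ j)) (ε ^ 2).toNNReal (z j).1)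

@[fun_prop]
theorem measurable_signMixtureDensity (ε : ℝ) (θ : EllTwo) (b δ : ℕ+ → ℝ) (S : Finset ℕ+) :
    Measurable (signMixtureDensity ε θ b δ S) :=
  Finset.measurable_fun_prod _ fun j _ => by fun_prop

theorem signMixtureDensity_apply_le {ε : ℝ} (hε : 0 < ε) {σ : ℝ} {θ : EllTwo} {b δ : ℕ+ → ℝ}
    {S : Finset ℕ+} {A : Set Obs} {c : ℝ≥0∞}
    (h : ∀ t, law ε σ (θ + signPerturbation S δ t) b A ≤ c) :
    ((law ε σ θ b).withDensity (signMixtureDensity ε θ b δ S)) A ≤ c := by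
  refine withDensity_prod_average_apply_le
    (f := fun j (z : Obs) => shiftDensity (b j * θ j) (b j * δ j) (ε ^ 2).toNNReal (z j).1)
    (g := fun j (z : Obs) => shiftDensity (b j * θ j) (-(b j * δ j)) (ε ^ 2).toNNReal (z j).1)
    (fun j => (measurable_shiftDensity _ _ _).comp (measurable_fst.comp (measurable_pi_apply j)))
    (fun j => (measurable_shiftDensity _ _ _).comp (measurable_fst.comp (measurable_pi_apply j)))
    fun t => ?_
  refine le_of_eq_of_le ?_ (h t)
  rw [law_add_eq_withDensity hε σ θ (signPerturbation S δ t) b (S := S)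
    fun j hj => by rw [signPerturbation, truncate_apply, if_neg hj]]
  congr 2
  ext z
  refine Finset.prod_congr rfl fun j hj => ?_
  rw [signPerturbation, truncate_apply, if_pos hj]
  split_ifs <;> simp

theorem lintegral_signMixtureDensity {ε : ℝ} (hε : 0 < ε) (σ : ℝ) (θ : EllTwo) (b δ : ℕ+ → ℝ)
    (S : Finset ℕ+) : ∫⁻ z, signMixtureDensity ε θ b δ S z ∂(law ε σ θ b) = 1 := by
  have hshift : ∀ m d, ∫⁻ x, shiftDensity m d (ε ^ 2).toNNReal x
      ∂(gaussianReal m (ε ^ 2).toNNReal) = 1 := fun m d => by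
    simpa [shiftDensity_zero] using lintegral_shiftDensity_mul m d 0 (toNNReal_sq_ne_zero hε)
  unfold signMixtureDensity
  rw [lintegral_law_prod_fst ε σ θ b S (f := fun j x => 2⁻¹ *
    (shiftDensity (b j * θ j) (b j * δ j) (ε ^ 2).toNNReal x +
      shiftDensity (b j * θ j) (-(b j * δ j)) (ε ^ 2).toNNReal x)) fun j => by fun_prop]
  refine Finset.prod_eq_one fun j _ => ?_
  rw [lintegral_const_mul _ (by fun_prop), lintegral_add_left (by fun_prop), hshift, hshift,
    one_add_one_eq_two, ENNReal.inv_mul_cancel two_ne_zero ENNReal.ofNat_ne_top]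

theorem lintegral_signMixtureDensity_sq_le {ε : ℝ} (hε : 0 < ε) (σ : ℝ) (θ : EllTwo)
    (b δ : ℕ+ → ℝ) (S : Finset ℕ+) :
    ∫⁻ z, signMixtureDensity ε θ b δ S z ^ 2 ∂(law ε σ θ b) ≤
      ENNReal.ofReal (Real.exp (∑ j ∈ S, ((b j * δ j) ^ 2 / ε ^ 2) ^ 2 / 2)) := by
  simp only [signMixtureDensity, ← Finset.prod_pow]
  rw [lintegral_law_prod_fst ε σ θ b S (f := fun j x => (2⁻¹ *
    (shiftDensity (b j * θ j) (b j * δ j) (ε ^ 2).toNNReal x +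
      shiftDensity (b j * θ j) (-(b j * δ j)) (ε ^ 2).toNNReal x)) ^ 2) fun j => by fun_prop,
    Real.exp_sum, ENNReal.ofReal_prod_of_nonneg fun j _ => Real.exp_nonneg _]
  gcongr with j
  rw [lintegral_average_shiftDensity_sq _ _ (toNNReal_sq_ne_zero hε), coe_toNNReal_sq]
  exact ENNReal.ofReal_le_ofReal (Real.cosh_le_exp_half_sq _)

theorem bigC_le_sum_of_signPerturbation {ε σ : ℝ} (hε : 0 < ε) {θ : EllTwo} {b δ : ℕ+ → ℝ}
    {S : Finset ℕ+} {T : Obs → Bool} (hT : Measurable T) {α β : ℝ} (hα : 0 ≤ α) (hβ : 0 ≤ β)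
    (hαβ : α + β ≤ 1) (h₀ : law ε σ θ b {z | T z = true} ≤ ENNReal.ofReal α)
    (h₁ : ∀ t, law ε σ (θ + signPerturbation S δ t) b {z | T z = false} ≤ ENNReal.ofReal β) :
    bigC α β ≤ ∑ j ∈ S, ((b j * δ j) ^ 2 / ε ^ 2) ^ 2 / 2 := by
  have hprob : IsProbabilityMeasure ((law ε σ θ b).withDensity (signMixtureDensity ε θ b δ S)) :=
    ⟨by rw [withDensity_apply _ MeasurableSet.univ, setLIntegral_univ,
      lintegral_signMixtureDensity hε]⟩
  exact bigC_le_of_lintegral_sq_le (by fun_prop) hT hα hβ hαβ h₀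
    (signMixtureDensity_apply_le hε h₁) (lintegral_signMixtureDensity_sq_le hε σ θ b δ S)

end TestingErrors

section LowerBounds

theorem ofReal_le_minimaxRadius_sq {a : ℕ+ → ℝ} {B : Set (ℕ+ → ℝ)} {α β ε σ y : ℝ}
    (h : ∀ Ψ, IsLevelTest a B α ε σ Ψ → ∀ r, 0 < r →
      secondKind a B ε σ Ψ r ≤ ENNReal.ofReal β → y ≤ r ^ 2) :
    ENNReal.ofReal y ≤ minimaxRadius a B α β ε σ ^ 2 := by
  have hsqrt : ENNReal.ofReal √y ≤ minimaxRadius a B α β ε σ :=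
    le_iInf₂ fun Ψ hΨ => le_iInf₂ fun r hr => ENNReal.ofReal_le_ofReal <|
      Real.sqrt_le_iff.2 ⟨hr.1.le, h Ψ hΨ r hr.1 hr.2⟩
  calc ENNReal.ofReal y ≤ ENNReal.ofReal (√y ^ 2) :=
        ENNReal.ofReal_le_ofReal (Real.sqrt_le_left (Real.sqrt_nonneg y) |>.1 le_rfl)
    _ = ENNReal.ofReal √y ^ 2 := ENNReal.ofReal_pow (Real.sqrt_nonneg y) 2
    _ ≤ minimaxRadius a B α β ε σ ^ 2 := pow_le_pow_left₀ zero_le hsqrt 2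

theorem law_le_of_secondKind_le {a : ℕ+ → ℝ} {B : Set (ℕ+ → ℝ)} {β ε σ r : ℝ} {Ψ : Procedure}
    (h : secondKind a B ε σ Ψ r ≤ ENNReal.ofReal β) {θ₀ θ : EllTwo} (hθ₀ : θ₀ ∈ benchmarks a)
    (hθ : θ - θ₀ ∈ alternatives a r) {ν : ℕ+ → ℝ} (hν : ν ∈ B) :
    law ε σ θ ν {z | Ψ θ₀ z = false} ≤ ENNReal.ofReal β :=
  h.trans' <| le_iSup₂_of_le θ₀ hθ₀ <| le_iSup₂_of_le θ hθ <| le_iSup₂_of_le ν hν le_rfl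

theorem self_mem_operatorClass {b : ℕ+ → ℝ} (hb : ∀ j, 0 < b j) {C₀ C₁ : ℝ} (hC₀ : C₀ ≤ 1)
    (hC₁ : 1 ≤ C₁) : b ∈ operatorClass C₀ C₁ b := fun j =>
  ⟨mul_le_of_le_one_left (hb j).le hC₀, le_mul_of_one_le_left (hb j).le hC₁⟩

theorem update_mem_operatorClass {b ν : ℕ+ → ℝ} {C₀ C₁ : ℝ} (hν : ν ∈ operatorClass C₀ C₁ b)
    {D : ℕ+} {x : ℝ} (h₀ : C₀ * b D ≤ x) (h₁ : x ≤ C₁ * b D) :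
    Function.update ν D x ∈ operatorClass C₀ C₁ b := by
  intro j
  rcases eq_or_ne j D with rfl | hj
  · rw [Function.update_self]
    exact ⟨h₀, h₁⟩
  · rw [Function.update_of_ne hj]
    exact hν j

theorem exists_ge_of_le_bandM₂ {α β C₀ C₁ σ : ℝ} {b : ℕ+ → ℝ} {D : ℕ+}
    (h : ((D : ℕ) : ℕ∞) ≤ bandM₂ α β C₀ C₁ σ b) :
    ∃ D', D ≤ D' ∧ bigC α β * σ * (b D')⁻¹ ≤ 2 ∧
      1 / √(1 + 4 * (1 - α - β) ^ 2) ≤ gaussMass C₀ C₁ σ b D' := by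
  have hlt : (((D : ℕ) - 1 : ℕ) : ℕ∞) < bandM₂ α β C₀ C₁ σ b :=
    lt_of_lt_of_le (Nat.cast_lt.2 (Nat.sub_lt D.pos one_pos)) h
  simp only [bandM₂, lt_iSup_iff] at hlt
  obtain ⟨D', hD', hlt⟩ := hlt
  exact ⟨D', PNat.coe_le_coe _ _ |>.1 (Nat.le_of_pred_lt (Nat.cast_lt.1 hlt)), hD'⟩

theorem gaussMass_le {C₀ C₁ σ : ℝ} (hσ : 0 ≤ σ) {b : ℕ+ → ℝ} {D : ℕ+}
    (h : C₀ * b D ≤ C₁ * b D) :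
    gaussMass C₀ C₁ σ b D ≤ 1 / (σ * √(2 * Real.pi)) * (C₁ * b D - C₀ * b D) := by
  have hexp : ∀ t, Real.exp (-(1 / (2 * σ ^ 2)) * (t - b D) ^ 2) ≤ 1 := fun t =>
    Real.exp_le_one_iff.2 (mul_nonpos_of_nonpos_of_nonneg (neg_nonpos.2 (by positivity))
      (sq_nonneg _))
  have hmono := intervalIntegral.integral_mono_on (μ := volume) h
    (Continuous.intervalIntegrable (by fun_prop) _ _) intervalIntegrable_const
    fun t _ => hexp t
  rw [intervalIntegral.integral_const, smul_eq_mul, mul_one] at hmono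
  exact mul_le_mul_of_nonneg_left hmono (by positivity)

theorem le_window_of_le_gaussMass {α β C₀ C₁ σ : ℝ} (hα : 0 ≤ α) (hβ : 0 ≤ β) (hαβ : α + β ≤ 1)
    (hσ : 0 < σ) {b : ℕ+ → ℝ} {D : ℕ+} (hC : C₀ * b D ≤ C₁ * b D)
    (h : 1 / √(1 + 4 * (1 - α - β) ^ 2) ≤ gaussMass C₀ C₁ σ b D) :
    σ ≤ C₁ * b D - C₀ * b D := by
  have hsqrt : √(1 + 4 * (1 - α - β) ^ 2) ≤ √(2 * Real.pi) :=
    Real.sqrt_le_sqrt (by nlinarith [Real.pi_gt_three])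
  have hpos : 0 < √(1 + 4 * (1 - α - β) ^ 2) := Real.sqrt_pos.2 (by positivity)
  have hratio : 1 / √(2 * Real.pi) ≤ (C₁ * b D - C₀ * b D) / (σ * √(2 * Real.pi)) :=
    (one_div_le_one_div_of_le hpos hsqrt).trans <| h.trans <|
      (gaussMass_le hσ.le hC).trans_eq (one_div_mul_eq_div _ _)
  rwa [div_le_div_iff₀ (hpos.trans_le hsqrt) (mul_pos hσ (hpos.trans_le hsqrt)), one_mul,
    mul_le_mul_iff_left₀ (hpos.trans_le hsqrt)] at hratio

theorem exists_sq_eq_add_mem_Icc {l u x δ : ℝ} (hx : x ∈ Set.Icc l u) (hδ : 0 ≤ δ)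
    (h : 2 * δ ≤ u - l) : ∃ κ, κ ^ 2 = δ ^ 2 ∧ x + κ ∈ Set.Icc l u := by
  obtain ⟨hl, hu⟩ := hx
  rcases le_total (x + δ) u with hup | hup
  · exact ⟨δ, rfl, by linarith, hup⟩
  · exact ⟨-δ, neg_sq δ, by linarith, by linarith⟩

theorem exists_shift_of_le_bandM₂ {α β C₀ C₁ σ : ℝ} (hα : 0 < α) (hβ : 0 < β)
    (hαβ : α + β < 1) (hC₀ : C₀ ≤ 1) (hC₁ : 1 ≤ C₁) (hσ : 0 < σ) {b : ℕ+ → ℝ}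
    (hb : ∀ j, 0 < b j) (hanti : Antitone b) {D : ℕ+}
    (h : ((D : ℕ) : ℕ∞) ≤ bandM₂ α β C₀ C₁ σ b) :
    ∃ κ, κ ^ 2 = (bigC α β / 4 * σ) ^ 2 ∧ κ ^ 2 ≤ b D ^ 2 ∧
      b D + κ ∈ Set.Icc (C₀ * b D) (C₁ * b D) := by
  obtain ⟨D', hDD', hratio, hmass⟩ := exists_ge_of_le_bandM₂ h
  have hbD : b D' ≤ b D := hanti hDD'
  have hC : 0 < bigC α β := bigC_pos hαβ
  have hC2 : bigC α β ≤ 2 := bigC_le_two hα hβ hαβ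
  have hratio' : bigC α β * σ ≤ 2 * b D := by
    rw [← div_eq_mul_inv, div_le_iff₀ (hb D')] at hratio
    linarith
  have hwindow : σ ≤ (C₁ - C₀) * b D := by
    have hD' := le_window_of_le_gaussMass hα.le hβ.le hαβ.le hσ
      (mul_le_mul_of_nonneg_right (hC₀.trans hC₁) (hb D').le) hmass
    rw [← sub_mul] at hD'
    exact hD'.trans (mul_le_mul_of_nonneg_left hbD (sub_nonneg.2 (hC₀.trans hC₁)))
  obtain ⟨κ, hκ, hmem⟩ := exists_sq_eq_add_mem_Icc (δ := bigC α β / 4 * σ)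
    (self_mem_operatorClass hb hC₀ hC₁ D) (by positivity) (by nlinarith)
  refine ⟨κ, hκ, hκ ▸ pow_le_pow_left₀ (by positivity) ?_ 2, hmem⟩
  have hCσ : 0 < bigC α β * σ := mul_pos hC hσ
  linarith

theorem bigC_le_of_singularValue_shift {a b : ℕ+ → ℝ} {α β C₀ C₁ ε σ r κ : ℝ} (hα : 0 ≤ α)
    (hβ : 0 ≤ β) (hαβ : α + β ≤ 1) (hσ : 0 < σ) {D : ℕ+} (haD : a D ≠ 0) (hbD : b D ≠ 0)
    (hb : b ∈ operatorClass C₀ C₁ b) (hκ : b D + κ ∈ Set.Icc (C₀ * b D) (C₁ * b D))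
    (hκb : κ ^ 2 ≤ b D ^ 2) (hr : r ^ 2 ≤ κ ^ 2 * ((b D ^ 2)⁻¹ * (a D ^ 2)⁻¹)) {Ψ : Procedure}
    (hΨ : IsLevelTest a (operatorClass C₀ C₁ b) α ε σ Ψ)
    (hsecond : secondKind a (operatorClass C₀ C₁ b) ε σ Ψ r ≤ ENNReal.ofReal β) :
    bigC α β ≤ κ ^ 2 / σ ^ 2 := by
  let δ : ℕ+ → ℝ := fun j => (a j)⁻¹ * ((b j + κ) / b j)
  have hθ₀ := truncate_singleton_mem_benchmarks haD
  set θ₀ := truncate {D} fun j => (a j)⁻¹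
  have hdiff : δ D - (a D)⁻¹ = κ / (a D * b D) := by
    simp only [δ]
    field_simp
    ring
  have hθ : truncate {D} δ - θ₀ ∈ alternatives a r := by
    rw [truncate_sub_truncate]
    refine truncate_mem_alternatives ?_ ?_ <;>
      rw [Finset.sum_singleton, Pi.sub_apply, hdiff, div_pow, mul_pow]
    · rw [← mul_div_assoc, mul_div_mul_left _ _ (pow_ne_zero 2 haD)]
      exact div_le_one_of_le₀ hκb (sq_nonneg _)
    · rwa [div_eq_mul_inv, mul_inv, mul_comm (a D ^ 2)⁻¹]
  have hmul : ∀ j, b j * truncate {D} δ j = Function.update b D (b D + κ) j * θ₀ j := by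
    intro j
    rw [truncate_apply, truncate_apply]
    rcases eq_or_ne j D with rfl | hj
    · simp only [Finset.mem_singleton, if_true, Function.update_self, δ]
      field_simp
    · simp only [Finset.mem_singleton, hj, if_false, mul_zero]
  have hle := bigC_le_sum_of_mul_eq (ε := ε) hσ hmul (S := {D})
    (fun j hj => (Function.update_of_ne (Finset.notMem_singleton.1 hj) _ _).symm) (hΨ.1 θ₀) hα hβ
    hαβ (hΨ.2 θ₀ hθ₀ _ (update_mem_operatorClass hb hκ.1 hκ.2))
    (law_le_of_secondKind_le hsecond hθ₀ hθ hb)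
  rwa [Finset.sum_singleton, Function.update_self, sub_add_cancel_left, neg_sq] at hle

theorem lowerSigma_le_minimaxRadius_sq {α β C₀ C₁ : ℝ} (hα : 0 < α) (hβ : 0 < β)
    (hαβ : α + β < 1) (hC₀ : C₀ ≤ 1) (hC₁ : 1 ≤ C₁) {a b : ℕ+ → ℝ} (ha : ∀ j, 0 < a j)
    (hb : ∀ j, 0 < b j) (hanti : Antitone b) (ε : ℝ) {σ : ℝ} (hσ : 0 < σ) :
    lowerSigma a b α β C₀ C₁ σ ≤ minimaxRadius a (operatorClass C₀ C₁ b) α β ε σ ^ 2 := by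
  refine iSup₂_le fun D hD => ofReal_le_minimaxRadius_sq fun Ψ hΨ r _ hsecond => ?_
  by_contra! hlt
  obtain ⟨κ, hκ, hκb, hmem⟩ := exists_shift_of_le_bandM₂ hα hβ hαβ hC₀ hC₁ hσ hb hanti hD
  have hκ' : κ ^ 2 = bigC α β ^ 2 / 16 * σ ^ 2 := by
    rw [hκ]
    ring
  have hle := bigC_le_of_singularValue_shift hα.le hβ.le hαβ.le hσ (ha D).ne' (hb D).ne'
    (self_mem_operatorClass hb hC₀ hC₁) hmem hκb (hκ' ▸ hlt.le) hΨ hsecond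
  rw [hκ', mul_div_cancel_right₀ _ (pow_ne_zero 2 hσ.ne')] at hle
  nlinarith [bigC_pos hαβ, bigC_le_two hα hβ hαβ]

theorem signPerturbation_mem_alternatives {a : ℕ+ → ℝ} {S : Finset ℕ+} {δ : ℕ+ → ℝ} {r : ℝ}
    (h : ∑ j ∈ S, a j ^ 2 * δ j ^ 2 ≤ 1) (hr : r ^ 2 ≤ ∑ j ∈ S, δ j ^ 2) (t : Finset ℕ+) :
    signPerturbation S δ t ∈ alternatives a r := by
  have hsign : ∀ j, (if j ∈ t then δ j else -δ j) ^ 2 = δ j ^ 2 := fun j => by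
    split_ifs
    exacts [rfl, neg_sq _]
  refine truncate_mem_alternatives ?_ ?_ <;> simpa only [hsign]

theorem bigC_le_of_isLevelTest_of_secondKind_le {a b : ℕ+ → ℝ} {B : Set (ℕ+ → ℝ)}
    {α β ε σ r : ℝ} (hα : 0 ≤ α) (hβ : 0 ≤ β) (hαβ : α + β ≤ 1) (hε : 0 < ε)
    (hbench : (benchmarks a).Nonempty) (hb : b ∈ B) {S : Finset ℕ+} {δ : ℕ+ → ℝ}
    (hδ : ∑ j ∈ S, a j ^ 2 * δ j ^ 2 ≤ 1) (hr : r ^ 2 ≤ ∑ j ∈ S, δ j ^ 2) {Ψ : Procedure}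
    (hΨ : IsLevelTest a B α ε σ Ψ) (hsecond : secondKind a B ε σ Ψ r ≤ ENNReal.ofReal β) :
    bigC α β ≤ ∑ j ∈ S, ((b j * δ j) ^ 2 / ε ^ 2) ^ 2 / 2 := by
  obtain ⟨θ₀, hθ₀⟩ := hbench
  refine bigC_le_sum_of_signPerturbation hε (hΨ.1 θ₀) hα hβ hαβ (hΨ.2 θ₀ hθ₀ b hb) fun t =>
    law_le_of_secondKind_le hsecond hθ₀ ?_ hb
  rw [add_sub_cancel_left]
  exact signPerturbation_mem_alternatives hδ hr t

theorem bigC_le_pow_four_div {a b : ℕ+ → ℝ} {B : Set (ℕ+ → ℝ)} {α β ε σ r : ℝ} (hα : 0 ≤ α)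
    (hβ : 0 ≤ β) (hαβ : α + β ≤ 1) (ha : ∀ j, 0 < a j) (ha_mono : Monotone a)
    (hb : ∀ j, 0 < b j) (hbB : b ∈ B) (hε : 0 < ε) {D : ℕ+} (hr : r ^ 2 ≤ (a D ^ 2)⁻¹)
    {Ψ : Procedure} (hΨ : IsLevelTest a B α ε σ Ψ)
    (hsecond : secondKind a B ε σ Ψ r ≤ ENNReal.ofReal β) :
    bigC α β ≤ r ^ 4 / (2 * ε ^ 4 * ∑ j ∈ Finset.Icc 1 D, (b j ^ 4)⁻¹) := by
  set S := Finset.Icc 1 D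
  set s := ∑ j ∈ S, (b j ^ 4)⁻¹ with hs
  have hspos : 0 < s := Finset.sum_pos (fun j _ => inv_pos.2 (pow_pos (hb j) 4))
    (Finset.nonempty_Icc.2 one_le)
  -- The bound depends on `∑ (b_j δ_j)⁴`, which `δ_j ∝ b_j⁻²` minimizes at fixed `∑ δ_j²`.
  let δ : ℕ+ → ℝ := fun j => r * (b j ^ 2)⁻¹ / √s
  have hδ : ∀ j, δ j ^ 2 = r ^ 2 / s * (b j ^ 4)⁻¹ := fun j => by
    simp only [δ, div_pow, Real.sq_sqrt hspos.le]
    ring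
  have hnorm : ∑ j ∈ S, δ j ^ 2 = r ^ 2 := by
    simp only [hδ, ← Finset.mul_sum, ← hs]
    exact div_mul_cancel₀ _ hspos.ne'
  have hellipsoid : ∑ j ∈ S, a j ^ 2 * δ j ^ 2 ≤ 1 := by
    calc ∑ j ∈ S, a j ^ 2 * δ j ^ 2 ≤ ∑ j ∈ S, a D ^ 2 * δ j ^ 2 := by
          gcongr with j hj
          exacts [(ha j).le, ha_mono (Finset.mem_Icc.1 hj).2]
      _ = a D ^ 2 * r ^ 2 := by rw [← Finset.mul_sum, hnorm]
      _ ≤ a D ^ 2 * (a D ^ 2)⁻¹ := by gcongr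
      _ = 1 := mul_inv_cancel₀ (pow_ne_zero 2 (ha D).ne')
  have hterm : ∀ j, ((b j * δ j) ^ 2 / ε ^ 2) ^ 2 / 2 =
      r ^ 4 / (2 * ε ^ 4 * s) / s * (b j ^ 4)⁻¹ := fun j => by
    have := (hb j).ne'
    rw [mul_pow, hδ]
    field_simp
  have hle := bigC_le_of_isLevelTest_of_secondKind_le hα hβ hαβ hε
    ⟨_, truncate_singleton_mem_benchmarks (ha 1).ne'⟩ hbB hellipsoid hnorm.ge hΨ hsecond
  simpa only [hterm, ← Finset.mul_sum, ← hs, div_mul_cancel₀ _ hspos.ne'] using hle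

theorem lowerEps_le_minimaxRadius_sq {α β : ℝ} (hα : 0 ≤ α) (hβ : 0 ≤ β) (hαβ : α + β < 1)
    {a b : ℕ+ → ℝ} (ha : ∀ j, 0 < a j) (ha_mono : Monotone a) (hb : ∀ j, 0 < b j)
    {B : Set (ℕ+ → ℝ)} (hbB : b ∈ B) {ε : ℝ} (hε : 0 < ε) (σ : ℝ) :
    lowerEps a b α β ε ≤ minimaxRadius a B α β ε σ ^ 2 := by
  refine iSup_le fun D => ofReal_le_minimaxRadius_sq fun Ψ hΨ r _ hsecond => ?_
  by_contra! hlt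
  obtain ⟨hlt_noise, hlt_bias⟩ := lt_min_iff.1 hlt
  have hle := bigC_le_pow_four_div hα hβ hαβ.le ha ha_mono hb hbB hε hlt_bias.le hΨ hsecond
  set s := ∑ j ∈ Finset.Icc 1 D, (b j ^ 4)⁻¹
  have hspos : 0 < s := Finset.sum_pos (fun j _ => inv_pos.2 (pow_pos (hb j) 4))
    (Finset.nonempty_Icc.2 one_le)
  have hC : 0 ≤ 2 * bigC α β := by linarith [bigC_pos hαβ]
  have hsq : r ^ 4 < bigC α β * (2 * ε ^ 4 * s) := by
    calc r ^ 4 = (r ^ 2) ^ 2 := by rw [← pow_mul]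
      _ < (smallC α β * ε ^ 2 * √s) ^ 2 :=
          pow_lt_pow_left₀ hlt_noise (sq_nonneg r) two_ne_zero
      _ = 2 * bigC α β * ε ^ 4 * s := by
          rw [mul_pow, mul_pow, smallC, ← bigC, Real.sq_sqrt hC, Real.sq_sqrt hspos.le, ← pow_mul]
      _ = bigC α β * (2 * ε ^ 4 * s) := by ring
  exact hle.not_gt ((div_lt_iff₀ (by positivity)).2 hsq)

end LowerBounds

section ChiSquareStatistic

variable {ι : Type*} {X : ι → Type*} [∀ i, MeasurableSpace (X i)]

theorem infinitePi_le_sum_le {μ : ∀ i, Measure (X i)} [∀ i, IsProbabilityMeasure (μ i)]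
    {S : Finset ι} {g : ∀ i, X i → ℝ} (hg : ∀ i, Measurable (g i)) {B : ι → ℝ}
    (hB : ∀ i ∈ S, ∫⁻ x, ENNReal.ofReal (Real.exp (g i x)) ∂(μ i) ≤
      ENNReal.ofReal (Real.exp (B i))) (c : ℝ) :
    Measure.infinitePi μ {z | c ≤ ∑ i ∈ S, g i (z i)} ≤
      ENNReal.ofReal (Real.exp (∑ i ∈ S, B i - c)) := by
  have hexp : ∀ i, Measurable fun x => ENNReal.ofReal (Real.exp (g i x)) := fun i =>
    (Real.measurable_exp.comp (hg i)).ennreal_ofReal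
  have hmarkov := mul_meas_ge_le_lintegral (μ := Measure.infinitePi μ)
    (Finset.measurable_fun_prod S fun i _ => (hexp i).comp (measurable_pi_apply i))
    (ENNReal.ofReal (Real.exp c))
  have hset : {z : ∀ i, X i | c ≤ ∑ i ∈ S, g i (z i)} =
      {z | ENNReal.ofReal (Real.exp c) ≤ ∏ i ∈ S, ENNReal.ofReal (Real.exp (g i (z i)))} := by
    ext z
    simp only [Set.mem_ofPred_eq]
    rw [← ENNReal.ofReal_prod_of_nonneg fun _ _ => Real.exp_nonneg _, ← Real.exp_sum,
      ENNReal.ofReal_le_ofReal_iff (Real.exp_nonneg _), Real.exp_le_exp]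
  rw [Real.exp_sub, ENNReal.ofReal_div_of_pos (Real.exp_pos c), hset]
  refine ENNReal.le_div_iff_mul_le (by simp [Real.exp_pos]) (by simp) |>.2 ?_
  rw [mul_comm]
  refine hmarkov.trans ?_
  simp only [Function.comp_apply]
  rw [lintegral_infinitePi_prod μ S hexp, Real.exp_sum,
    ENNReal.ofReal_prod_of_nonneg fun _ _ => Real.exp_nonneg _]
  exact Finset.prod_le_prod' hB

/-- The weighted sum `∑ t_i (ζ_i² - v_i)` of centred squares, where `ζ_i` is a function of the
`i`-th observation with variance `v_i`. -/
noncomputable def chiSquareStat (S : Finset ι) (t : ι → ℝ) (v : ι → ℝ≥0) (ζ : ∀ i, X i → ℝ)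
    (z : ∀ i, X i) : ℝ :=
  ∑ i ∈ S, t i * (ζ i (z i) ^ 2 - v i)

theorem measurable_chiSquareStat (S : Finset ι) (t : ι → ℝ) (v : ι → ℝ≥0) {ζ : ∀ i, X i → ℝ}
    (hζ : ∀ i, Measurable (ζ i)) : Measurable (chiSquareStat S t v ζ) :=
  Finset.measurable_fun_sum S fun i _ =>
    ((((hζ i).comp (measurable_pi_apply i)).pow_const 2).sub_const _).const_mul _

variable {μ : ∀ i, Measure (X i)} [∀ i, IsProbabilityMeasure (μ i)] {S : Finset ι} {t : ι → ℝ}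
  {v : ι → ℝ≥0} {ζ : ∀ i, X i → ℝ}

theorem infinitePi_le_chiSquareStat_le (hζ : ∀ i, Measurable (ζ i)) (hv : ∀ i, v i ≠ 0)
    (ht : ∀ i, 0 ≤ t i) (htv : ∀ i ∈ S, t i * v i ≤ 1 / 4)
    (hμ : ∀ i, (μ i).map (ζ i) = gaussianReal 0 (v i)) (c : ℝ) :
    Measure.infinitePi μ {z | c ≤ chiSquareStat S t v ζ z} ≤
      ENNReal.ofReal (Real.exp (2 * ∑ i ∈ S, (t i * v i) ^ 2 - c)) := by
  rw [Finset.mul_sum]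
  refine infinitePi_le_sum_le (g := fun i x => t i * (ζ i x ^ 2 - v i))
    (fun i => (((hζ i).pow_const 2).sub_const _).const_mul _) (fun i hi => ?_) c
  rw [← lintegral_map (f := fun y => ENNReal.ofReal (Real.exp (t i * (y ^ 2 - v i))))
    (by fun_prop) (hζ i), hμ i]
  exact lintegral_exp_sq_sub_var_le (hv i) (ht i) (htv i hi)

theorem infinitePi_chiSquareStat_le_le (hζ : ∀ i, Measurable (ζ i)) (hv : ∀ i, v i ≠ 0)
    (ht : ∀ i, 0 ≤ t i) (htv : ∀ i ∈ S, t i * v i ≤ 1 / 4) {m : ι → ℝ}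
    (hμ : ∀ i, (μ i).map (ζ i) = gaussianReal (m i) (v i)) (c : ℝ) :
    Measure.infinitePi μ {z | chiSquareStat S t v ζ z ≤ c} ≤ ENNReal.ofReal
      (Real.exp (c + ∑ i ∈ S, (t i * v i) ^ 2 - 2 / 3 * ∑ i ∈ S, t i * m i ^ 2)) := by
  have hset : {z | chiSquareStat S t v ζ z ≤ c} =
      {z | -c ≤ ∑ i ∈ S, -(t i * (ζ i (z i) ^ 2 - v i))} := by
    ext z
    simp only [Set.mem_ofPred_eq, Finset.sum_neg_distrib, neg_le_neg_iff, chiSquareStat]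
  have hexponent : c + ∑ i ∈ S, (t i * v i) ^ 2 - 2 / 3 * ∑ i ∈ S, t i * m i ^ 2 =
      ∑ i ∈ S, ((t i * v i) ^ 2 - 2 / 3 * (t i * m i ^ 2)) - -c := by
    rw [Finset.sum_sub_distrib, Finset.mul_sum]
    ring
  rw [hset, hexponent]
  refine infinitePi_le_sum_le (g := fun i x => -(t i * (ζ i x ^ 2 - v i)))
    (fun i => ((((hζ i).pow_const 2).sub_const _).const_mul _).neg) (fun i hi => ?_) _
  rw [← lintegral_map (f := fun y => ENNReal.ofReal (Real.exp (-(t i * (y ^ 2 - v i)))))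
    (by fun_prop) (hζ i), hμ i]
  exact lintegral_exp_neg_sq_sub_var_le (m i) (hv i) (ht i) (htv i hi)

theorem le_of_sum_sq_le_sq {S : Finset ι} {f : ι → ℝ} {c : ℝ} (hc : 0 ≤ c)
    (h : ∑ i ∈ S, f i ^ 2 ≤ c ^ 2) {i : ι} (hi : i ∈ S) : f i ≤ c :=
  (abs_le_of_sq_le_sq' ((Finset.single_le_sum (f := fun i => f i ^ 2)
    (fun _ _ => sq_nonneg _) hi).trans h) hc).2

theorem sum_add_sq_le {S : Finset ι} {p q : ι → ℝ} {A B : ℝ} (hA : 0 ≤ A)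
    (hp : ∑ i ∈ S, p i ^ 2 ≤ A ^ 2) (hq : ∀ i ∈ S, 0 ≤ q i) (hB : ∑ i ∈ S, q i ≤ B) :
    ∑ i ∈ S, (p i + q i) ^ 2 ≤ (A + B) ^ 2 := by
  have hqsum : 0 ≤ ∑ i ∈ S, q i := Finset.sum_nonneg hq
  have hcross : ∑ i ∈ S, p i * q i ≤ A * B := by
    calc ∑ i ∈ S, p i * q i ≤ ∑ i ∈ S, A * q i := Finset.sum_le_sum fun i hi =>
          mul_le_mul_of_nonneg_right (le_of_sum_sq_le_sq hA hp hi) (hq i hi)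
      _ = A * ∑ i ∈ S, q i := (Finset.mul_sum _ _ _).symm
      _ ≤ A * B := mul_le_mul_of_nonneg_left hB hA
  have hqsq : ∑ i ∈ S, q i ^ 2 ≤ B ^ 2 :=
    (Finset.sum_sq_le_sq_sum_of_nonneg hq).trans (pow_le_pow_left₀ hqsum hB 2)
  calc ∑ i ∈ S, (p i + q i) ^ 2
      = ∑ i ∈ S, p i ^ 2 + 2 * ∑ i ∈ S, p i * q i + ∑ i ∈ S, q i ^ 2 := by
        simp only [add_sq, mul_assoc, Finset.sum_add_distrib, ← Finset.mul_sum]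
    _ ≤ A ^ 2 + 2 * (A * B) + B ^ 2 := by gcongr
    _ = (A + B) ^ 2 := by ring

end ChiSquareStatistic

section ChiSquareTest

/-- The variance `ε² + τ² θ₀_j²` of a residual: the second term accounts for replacing the
singular value `ν_j` by an estimate with standard deviation `τ`. -/
noncomputable def residualVar (ε τ : ℝ) (θ₀ : EllTwo) (j : ℕ+) : ℝ≥0 :=
  (ε ^ 2 + τ ^ 2 * θ₀ j ^ 2).toNNReal

/-- `ζ θ₀ j` is a function of the `j`-th observation that is Gaussian with mean `ν_j (θ_j - θ₀_j)`
and variance `residualVar ε τ θ₀ j`, for all singular values `ν` in `B`. It serves to test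
`θ = θ₀`. If `B = {b}`, then `Y_j - b_j θ₀_j` has this property with `τ = 0`; for any `B`,
`Y_j - θ₀_j X_j` has it with `τ = σ`. -/
structure IsGaussianResidual (B : Set (ℕ+ → ℝ)) (ε σ τ : ℝ)
    (ζ : EllTwo → ℕ+ → ℝ × ℝ → ℝ) : Prop where
  measurable : ∀ θ₀ j, Measurable (ζ θ₀ j)
  map_eq : ∀ θ₀ θ : EllTwo, ∀ ν ∈ B, ∀ j, (coordLaw ε σ (θ j) (ν j)).map (ζ θ₀ j) =
    gaussianReal (ν j * (θ j - θ₀ j)) (residualVar ε τ θ₀ j)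

theorem isGaussianResidual_of_known (b : ℕ+ → ℝ) (ε σ : ℝ) :
    IsGaussianResidual (operatorClass 1 1 b) ε σ 0 fun θ₀ j p => p.1 - b j * θ₀ j where
  measurable θ₀ j := measurable_fst.sub_const _
  map_eq θ₀ θ ν hν j := by
    have hνb : ν j = b j := by simpa using le_antisymm (hν j).2 (hν j).1
    have hfst : (coordLaw ε σ (θ j) (ν j)).map (fun p => p.1 - b j * θ₀ j) =
        ((coordLaw ε σ (θ j) (ν j)).map Prod.fst).map (· - b j * θ₀ j) :=
      (Measure.map_map (g := fun x => x - b j * θ₀ j) (by fun_prop) measurable_fst).symm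
    rw [hfst, coordLaw, measurePreserving_fst.map_eq, gaussianReal_map_sub_const, residualVar, hνb,
      mul_sub]
    simp

theorem isGaussianResidual_of_unknown (B : Set (ℕ+ → ℝ)) (ε σ : ℝ) :
    IsGaussianResidual B ε σ σ fun θ₀ j p => p.1 - θ₀ j * p.2 where
  measurable θ₀ j := measurable_fst.sub (measurable_snd.const_mul _)
  map_eq θ₀ θ ν _ j := by
    have hvar : residualVar ε σ θ₀ j =
        (ε ^ 2).toNNReal + (θ₀ j ^ 2).toNNReal * (σ ^ 2).toNNReal := by
      rw [residualVar, Real.toNNReal_add (sq_nonneg _) (by positivity), mul_comm,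
        Real.toNNReal_mul (sq_nonneg _)]
    rw [coordLaw, gaussianReal_prod_map_sub_const_mul, hvar, mul_sub, mul_comm (θ₀ j)]

theorem residualVar_ne_zero {ε : ℝ} (hε : 0 < ε) (τ : ℝ) (θ₀ : EllTwo) (j : ℕ+) :
    residualVar ε τ θ₀ j ≠ 0 :=
  (Real.toNNReal_pos.2 (by positivity)).ne'

theorem coe_residualVar (ε τ : ℝ) (θ₀ : EllTwo) (j : ℕ+) :
    (residualVar ε τ θ₀ j : ℝ) = ε ^ 2 + τ ^ 2 * θ₀ j ^ 2 :=
  Real.coe_toNNReal _ (by positivity)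

/-- The test that rejects `θ = θ₀` for large values of the chi-square statistic of the residuals
`ζ θ₀`. The summand `1 / 8` in the critical value bounds the logarithmic moment generating function
of the statistic under the null hypothesis, for weights that satisfy `∑ (t_j v_j)² ≤ 1 / 16`. -/
noncomputable def chiSquareTest (α ε τ : ℝ) (ζ : EllTwo → ℕ+ → ℝ × ℝ → ℝ) (S : Finset ℕ+)
    (t : ℕ+ → ℝ) : Procedure := fun θ₀ z =>
  decide (Real.log (1 / α) + 1 / 8 ≤ chiSquareStat S t (residualVar ε τ θ₀) (ζ θ₀) z)

variable {a : ℕ+ → ℝ} {B : Set (ℕ+ → ℝ)} {α β ε σ τ r : ℝ} {ζ : EllTwo → ℕ+ → ℝ × ℝ → ℝ}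
  {S : Finset ℕ+} {t : ℕ+ → ℝ}

theorem isLevelTest_chiSquareTest (hα : 0 < α) (hε : 0 < ε) (hζ : IsGaussianResidual B ε σ τ ζ)
    (ht : ∀ j, 0 ≤ t j)
    (hsum : ∀ θ₀ ∈ benchmarks a, ∑ j ∈ S, (t j * residualVar ε τ θ₀ j) ^ 2 ≤ (1 / 4) ^ 2) :
    IsLevelTest a B α ε σ (chiSquareTest α ε τ ζ S t) := by
  refine ⟨fun θ₀ => measurable_to_bool ?_, fun θ₀ hθ₀ ν hν => ?_⟩
  · simpa only [Set.preimage, chiSquareTest, Set.mem_singleton_iff, decide_eq_true_eq] using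
      measurableSet_le measurable_const (measurable_chiSquareStat S t _ (hζ.measurable θ₀))
  have htail := infinitePi_le_chiSquareStat_le (hζ.measurable θ₀) (residualVar_ne_zero hε τ θ₀) ht
    (fun j => le_of_sum_sq_le_sq (by norm_num) (hsum θ₀ hθ₀))
    (fun j => by simpa using hζ.map_eq θ₀ θ₀ ν hν j) (Real.log (1 / α) + 1 / 8)
  simp only [chiSquareTest, decide_eq_true_eq]
  refine htail.trans (ENNReal.ofReal_le_ofReal ?_)
  rw [← Real.le_log_iff_exp_le hα, one_div, Real.log_inv]
  linarith [hsum θ₀ hθ₀]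

theorem secondKind_chiSquareTest_le (hβ : 0 < β) (hε : 0 < ε) (hζ : IsGaussianResidual B ε σ τ ζ)
    (ht : ∀ j, 0 ≤ t j)
    (hsum : ∀ θ₀ ∈ benchmarks a, ∑ j ∈ S, (t j * residualVar ε τ θ₀ j) ^ 2 ≤ (1 / 4) ^ 2)
    (hsignal : ∀ δ ∈ alternatives a r, ∀ ν ∈ B,
      Real.log (1 / α) + Real.log (1 / β) + 3 / 16 ≤ 2 / 3 * ∑ j ∈ S, t j * (ν j * δ j) ^ 2) :
    secondKind a B ε σ (chiSquareTest α ε τ ζ S t) r ≤ ENNReal.ofReal β := by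
  refine iSup₂_le fun θ₀ hθ₀ => iSup₂_le fun θ hθ => iSup₂_le fun ν hν => ?_
  have htail := infinitePi_chiSquareStat_le_le (hζ.measurable θ₀) (residualVar_ne_zero hε τ θ₀) ht
    (fun j => le_of_sum_sq_le_sq (by norm_num) (hsum θ₀ hθ₀)) (hζ.map_eq θ₀ θ ν hν)
    (Real.log (1 / α) + 1 / 8)
  simp only [chiSquareTest, decide_eq_false_iff_not, not_le]
  refine le_trans (measure_mono ?_) (htail.trans (ENNReal.ofReal_le_ofReal ?_))
  · exact Set.ofPred_subset_ofPred.2 fun z hz => le_of_lt hz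
  have hδ : ∀ j, (θ - θ₀) j = θ j - θ₀ j := fun j => rfl
  have hsig := hsignal _ hθ ν hν
  simp only [hδ] at hsig
  rw [← Real.le_log_iff_exp_le hβ, ← neg_neg (Real.log β), ← Real.log_inv, ← one_div]
  linarith [hsum θ₀ hθ₀]

/-- The weight `t_j` of the squared residual of mean `ν_j δ_j`, with `ν_j` comparable to `b_j`: up
to the normalisation `4 W`, it makes the statistic an estimator of the squared norm of `δ`. -/
noncomputable def inverseWeight (b : ℕ+ → ℝ) (W : ℝ) (j : ℕ+) : ℝ := (4 * W * b j ^ 2)⁻¹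

theorem inverseWeight_nonneg (b : ℕ+ → ℝ) {W : ℝ} (hW : 0 ≤ W) (j : ℕ+) :
    0 ≤ inverseWeight b W j := by
  unfold inverseWeight
  positivity

theorem sum_sq_mul_sq_div_sq_le {a b : ℕ+ → ℝ} (ha : ∀ j, 0 < a j) (hb : ∀ j, 0 < b j)
    {θ : EllTwo} (hθ : θ ∈ ellipsoid a) {Bd : ℝ} (hBd₀ : 0 ≤ Bd)
    (hBd : ∀ j ∈ S, τ ^ 2 * (a j * b j)⁻¹ ^ 2 ≤ Bd) :
    ∑ j ∈ S, τ ^ 2 * θ j ^ 2 / b j ^ 2 ≤ Bd := by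
  calc ∑ j ∈ S, τ ^ 2 * θ j ^ 2 / b j ^ 2
      = ∑ j ∈ S, τ ^ 2 * (a j * b j)⁻¹ ^ 2 * (a j ^ 2 * θ j ^ 2) :=
        Finset.sum_congr rfl fun j _ => by
          have := (ha j).ne'
          have := (hb j).ne'
          field_simp
    _ ≤ ∑ j ∈ S, Bd * (a j ^ 2 * θ j ^ 2) := Finset.sum_le_sum fun j hj =>
        mul_le_mul_of_nonneg_right (hBd j hj) (by positivity)
    _ = Bd * ∑ j ∈ S, a j ^ 2 * θ j ^ 2 := (Finset.mul_sum _ _ _).symm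
    _ ≤ Bd := mul_le_of_le_one_right hBd₀
        ((hθ.1.sum_le_tsum S fun j _ => by positivity).trans hθ.2)

theorem sum_inverseWeight_mul_residualVar_sq_le {a b : ℕ+ → ℝ} (ha : ∀ j, 0 < a j)
    (hb : ∀ j, 0 < b j) {θ₀ : EllTwo} (hθ₀ : θ₀ ∈ ellipsoid a) {Bd W : ℝ} (hBd₀ : 0 ≤ Bd)
    (hBd : ∀ j ∈ S, τ ^ 2 * (a j * b j)⁻¹ ^ 2 ≤ Bd) (hW₀ : 0 < W)
    (hW : ε ^ 2 * √(∑ j ∈ S, (b j ^ 4)⁻¹) + Bd ≤ W) :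
    ∑ j ∈ S, (inverseWeight b W j * residualVar ε τ θ₀ j) ^ 2 ≤ (1 / 4) ^ 2 := by
  have hε : ∑ j ∈ S, (ε ^ 2 / b j ^ 2) ^ 2 = (ε ^ 2 * √(∑ j ∈ S, (b j ^ 4)⁻¹)) ^ 2 := by
    rw [mul_pow, Real.sq_sqrt (Finset.sum_nonneg fun j _ => by positivity), Finset.mul_sum]
    exact Finset.sum_congr rfl fun j _ => by rw [div_pow]; ring
  have hvar : ∑ j ∈ S, (ε ^ 2 / b j ^ 2 + τ ^ 2 * θ₀ j ^ 2 / b j ^ 2) ^ 2 ≤ W ^ 2 :=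
    (sum_add_sq_le (by positivity) hε.le (fun j _ => by positivity)
      (sum_sq_mul_sq_div_sq_le ha hb hθ₀ hBd₀ hBd)).trans (pow_le_pow_left₀ (by positivity) hW 2)
  calc ∑ j ∈ S, (inverseWeight b W j * residualVar ε τ θ₀ j) ^ 2
      = (16 * W ^ 2)⁻¹ * ∑ j ∈ S, (ε ^ 2 / b j ^ 2 + τ ^ 2 * θ₀ j ^ 2 / b j ^ 2) ^ 2 := by
        rw [Finset.mul_sum]
        refine Finset.sum_congr rfl fun j _ => ?_
        rw [inverseWeight, coe_residualVar]
        have := (hb j).ne'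
        field_simp
        ring
    _ ≤ (16 * W ^ 2)⁻¹ * W ^ 2 := mul_le_mul_of_nonneg_left hvar (by positivity)
    _ = (1 / 4) ^ 2 := by
        field_simp
        norm_num

theorem norm_sq_le_sum_add_of_mem_ellipsoid {a : ℕ+ → ℝ} (ha : ∀ j, 0 < a j) (ha_mono : Monotone a)
    {δ : EllTwo} (hδ : δ ∈ ellipsoid a) (N : ℕ+) :
    ‖δ‖ ^ 2 ≤ ∑ j ∈ Finset.Icc 1 N, δ j ^ 2 + (a N ^ 2)⁻¹ := by
  have haN : 0 < a N ^ 2 := pow_pos (ha N) 2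
  have htail : ∀ j : ↥((Finset.Icc 1 N : Set ℕ+)ᶜ),
      δ j ^ 2 ≤ (a N ^ 2)⁻¹ * (a j ^ 2 * δ j ^ 2) := fun j => by
    have hNj : N ≤ j := le_of_not_ge fun hjN => j.2 (Finset.mem_Icc.2 ⟨one_le, hjN⟩)
    rw [← mul_assoc]
    refine le_mul_of_one_le_left (sq_nonneg _) ?_
    rw [← div_eq_inv_mul, one_le_div haN]
    exact pow_le_pow_left₀ (ha N).le (ha_mono hNj) 2
  rw [norm_sq_eq_tsum, ← (summable_sq δ).sum_add_tsum_compl (s := Finset.Icc 1 N)]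
  gcongr
  calc ∑' j : ↥((Finset.Icc 1 N : Set ℕ+)ᶜ), δ j ^ 2
      ≤ ∑' j : ↥((Finset.Icc 1 N : Set ℕ+)ᶜ), (a N ^ 2)⁻¹ * (a j ^ 2 * δ j ^ 2) :=
        ((summable_sq δ).subtype _).tsum_le_tsum htail ((hδ.1.subtype _).mul_left _)
    _ = (a N ^ 2)⁻¹ * ∑' j : ↥((Finset.Icc 1 N : Set ℕ+)ᶜ), a j ^ 2 * δ j ^ 2 := tsum_mul_left
    _ ≤ (a N ^ 2)⁻¹ := mul_le_of_le_one_right (inv_pos.2 haN).le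
        ((hδ.1.tsum_subtype_le _ _ fun j => by positivity).trans hδ.2)

theorem le_sum_inverseWeight_mul_sq {a b : ℕ+ → ℝ} (ha : ∀ j, 0 < a j) (ha_mono : Monotone a)
    (hb : ∀ j, 0 < b j) {C₀ C₁ W : ℝ} (hC₀ : 0 ≤ C₀) (hW : 0 < W) (hr : 0 ≤ r) {δ : EllTwo}
    (hδ : δ ∈ alternatives a r) {ν : ℕ+ → ℝ} (hν : ν ∈ operatorClass C₀ C₁ b) (N : ℕ+) :
    C₀ ^ 2 * (r ^ 2 - (a N ^ 2)⁻¹) / (4 * W) ≤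
      ∑ j ∈ Finset.Icc 1 N, inverseWeight b W j * (ν j * δ j) ^ 2 := by
  have hnorm := norm_sq_le_sum_add_of_mem_ellipsoid ha ha_mono hδ.1 N
  have hr_sq : r ^ 2 ≤ ‖δ‖ ^ 2 := pow_le_pow_left₀ hr hδ.2 2
  calc C₀ ^ 2 * (r ^ 2 - (a N ^ 2)⁻¹) / (4 * W)
      ≤ C₀ ^ 2 * (∑ j ∈ Finset.Icc 1 N, δ j ^ 2) / (4 * W) := by
        gcongr
        linarith
    _ = ∑ j ∈ Finset.Icc 1 N, inverseWeight b W j * (C₀ * b j * δ j) ^ 2 := by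
        rw [Finset.mul_sum, Finset.sum_div]
        refine Finset.sum_congr rfl fun j _ => ?_
        have := (hb j).ne'
        rw [inverseWeight]
        field_simp
    _ ≤ ∑ j ∈ Finset.Icc 1 N, inverseWeight b W j * (ν j * δ j) ^ 2 :=
        Finset.sum_le_sum fun j _ => by
          have hνj : (C₀ * b j) ^ 2 ≤ ν j ^ 2 :=
            pow_le_pow_left₀ (mul_nonneg hC₀ (hb j).le) (hν j).1 2
          rw [mul_pow, mul_pow (ν j)]
          exact mul_le_mul_of_nonneg_left (mul_le_mul_of_nonneg_right hνj (sq_nonneg _))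
            (inverseWeight_nonneg b hW.le j)

theorem minimaxRadius_le_of_isGaussianResidual {a b : ℕ+ → ℝ} {C₀ C₁ : ℝ} (hα : 0 < α)
    (hβ : 0 < β) (ha : ∀ j, 0 < a j) (ha_mono : Monotone a) (hb : ∀ j, 0 < b j) (hC₀ : 0 ≤ C₀)
    (hε : 0 < ε) (hζ : IsGaussianResidual (operatorClass C₀ C₁ b) ε σ τ ζ) (N : ℕ+) {Bd : ℝ}
    (hBd₀ : 0 ≤ Bd) (hBd : ∀ j ≤ N, τ ^ 2 * (a j * b j)⁻¹ ^ 2 ≤ Bd) (hr : 0 < r)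
    (hrad : 6 * (ε ^ 2 * √(∑ j ∈ Finset.Icc 1 N, (b j ^ 4)⁻¹) + Bd) *
      (Real.log (1 / α) + Real.log (1 / β) + 3 / 16) ≤ C₀ ^ 2 * (r ^ 2 - (a N ^ 2)⁻¹)) :
    minimaxRadius a (operatorClass C₀ C₁ b) α β ε σ ≤ ENNReal.ofReal r := by
  set W := ε ^ 2 * √(∑ j ∈ Finset.Icc 1 N, (b j ^ 4)⁻¹) + Bd with hW_def
  have hW : 0 < W := by
    have hsum : 0 < ∑ j ∈ Finset.Icc 1 N, (b j ^ 4)⁻¹ := Finset.sum_pos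
      (fun j _ => inv_pos.2 (pow_pos (hb j) 4)) ⟨1, Finset.mem_Icc.2 ⟨le_rfl, one_le⟩⟩
    have := Real.sqrt_pos.2 hsum
    positivity
  have ht := inverseWeight_nonneg b hW.le
  have hvar : ∀ θ₀ ∈ benchmarks a, ∑ j ∈ Finset.Icc 1 N,
      (inverseWeight b W j * residualVar ε τ θ₀ j) ^ 2 ≤ (1 / 4) ^ 2 := fun θ₀ hθ₀ =>
    sum_inverseWeight_mul_residualVar_sq_le ha hb hθ₀.1 hBd₀
      (fun j hj => hBd j (Finset.mem_Icc.1 hj).2) hW hW_def.ge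
  refine (iInf₂_le _ (isLevelTest_chiSquareTest hα hε hζ ht hvar)).trans
    (iInf₂_le r ⟨hr, secondKind_chiSquareTest_le hβ hε hζ ht hvar fun δ hδ ν hν => ?_⟩)
  calc Real.log (1 / α) + Real.log (1 / β) + 3 / 16
      ≤ 2 / 3 * (C₀ ^ 2 * (r ^ 2 - (a N ^ 2)⁻¹) / (4 * W)) := by
        rw [← mul_div_assoc, le_div_iff₀ (by positivity)]
        linarith
    _ ≤ _ := mul_le_mul_of_nonneg_left
        (le_sum_inverseWeight_mul_sq ha ha_mono hb hC₀ hW hr.le hδ hν N) (by norm_num)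

end ChiSquareTest

section Cutoff

theorem one_le_kappa : 1 ≤ kappa := by
  unfold kappa
  nlinarith [sq_nonneg Real.pi]

theorem hZero_nonneg (α : ℝ) (j : ℕ+) : 0 ≤ hZero α j := by
  unfold hZero
  positivity

theorem sqrt_log_le_hZero (α : ℝ) (j : ℕ+) :
    √(Real.log (kappa * (j : ℝ) ^ 2 / α)) ≤ hZero α j := by
  unfold hZero
  linarith [Real.sqrt_nonneg (Real.log (kappa * (j : ℝ) ^ 2 / α)),
    Real.sqrt_nonneg (2 * Real.log (10 / α))]

theorem hOne_le_hZero (α : ℝ) (j : ℕ+) : hOne α j ≤ hZero α j := by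
  unfold hOne hZero
  linarith [Real.sqrt_nonneg (Real.log (kappa * (j : ℝ) ^ 2 / α)),
    Real.sqrt_nonneg (2 * Real.log (10 / α))]

theorem log_le_hZero_sq {α : ℝ} (hα : 0 < α) (hα₁ : α ≤ 1) (j : ℕ+) :
    Real.log j ≤ hZero α j ^ 2 := by
  have hj : (1 : ℝ) ≤ j := by exact_mod_cast j.pos
  have hle : (j : ℝ) ≤ kappa * (j : ℝ) ^ 2 / α := by
    rw [le_div_iff₀ hα]
    nlinarith [mul_le_mul_of_nonneg_right one_le_kappa (sq_nonneg (j : ℝ))]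
  have hlog : Real.log j ≤ Real.log (kappa * (j : ℝ) ^ 2 / α) :=
    Real.log_le_log (by linarith) hle
  calc Real.log j ≤ √(Real.log (kappa * (j : ℝ) ^ 2 / α)) ^ 2 := by
        rwa [Real.sq_sqrt ((Real.log_nonneg hj).trans hlog)]
    _ ≤ hZero α j ^ 2 := pow_le_pow_left₀ (Real.sqrt_nonneg _) (sqrt_log_le_hZero α j) 2

theorem mul_hZero_lt_of_le_bandM₀ {α σ : ℝ} {b : ℕ+ → ℝ} {N : ℕ+}
    (hN : ((N : ℕ) : ℕ∞) ≤ bandM₀ α σ b) {j : ℕ+} (hj : j ≤ N) : σ * hZero α j < b j := by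
  by_contra! hbj
  have hband : bandM₀ α σ b ≤ (((j : ℕ) - 1 : ℕ) : ℕ∞) := by
    push_cast
    exact tsub_le_tsub_right (iInf₂_le (f := fun (j : ℕ+) (_ : b j ≤ σ * hZero α j) =>
      ((j : ℕ) : ℕ∞)) j hbj) 1
  have hNj : (N : ℕ) ≤ (j : ℕ) - 1 := by exact_mod_cast hN.trans hband
  have hjN : (j : ℕ) ≤ N := hj
  have := j.pos
  omega

theorem le_bandM₁_of_le_bandM₀ {α σ : ℝ} (hσ : 0 ≤ σ) {b : ℕ+ → ℝ} {N : ℕ+}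
    (hN : ((N : ℕ) : ℕ∞) ≤ bandM₀ α σ b) : ((N : ℕ) : ℕ∞) ≤ bandM₁ α σ b := by
  refine le_iInf₂ fun j hj => ?_
  by_contra! hlt
  have hjN : (j : ℕ) ≤ N := by exact_mod_cast hlt.le
  exact absurd (mul_hZero_lt_of_le_bandM₀ hN hjN)
    (hj.trans (mul_le_mul_of_nonneg_left (hOne_le_hZero α j) hσ)).not_gt

theorem invSq_toNat_min_eq_top_or (a : ℕ+ → ℝ) (D : ℕ+) (M : ℕ∞) :
    invSq a (min ((D : ℕ) : ℕ∞) M).toNat = ⊤ ∨ ∃ N ≤ D, ((N : ℕ) : ℕ∞) ≤ M ∧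
      invSq a (min ((D : ℕ) : ℕ∞) M).toNat = ENNReal.ofReal (a N ^ 2)⁻¹ := by
  have hcast : ((min ((D : ℕ) : ℕ∞) M).toNat : ℕ∞) = min ((D : ℕ) : ℕ∞) M :=
    ENat.natCast_toNat (ne_top_of_le_ne_top (ENat.natCast_ne_top _) (min_le_left _ _))
  by_cases h : 0 < (min ((D : ℕ) : ℕ∞) M).toNat
  · refine Or.inr ⟨⟨_, h⟩, ?_, hcast.trans_le (min_le_right _ _), dif_pos h⟩
    exact_mod_cast hcast.trans_le (min_le_left _ _)
  · exact Or.inl (dif_neg h)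

theorem sum_Icc_le_sum_filter_natCast_le {f : ℕ+ → ℝ} (hf : ∀ j, 0 ≤ f j) {N D : ℕ+} (hND : N ≤ D)
    {M : ℕ∞} (hNM : ((N : ℕ) : ℕ∞) ≤ M) :
    ∑ j ∈ Finset.Icc 1 N, f j ≤
      ∑ j ∈ (Finset.Icc 1 D).filter (fun j : ℕ+ => ((j : ℕ) : ℕ∞) ≤ M), f j := by
  refine Finset.sum_le_sum_of_subset_of_nonneg (fun j hj => ?_) fun j _ _ => hf j
  have hjN := (Finset.mem_Icc.1 hj).2
  have hcast : ((j : ℕ) : ℕ∞) ≤ (N : ℕ) := by exact_mod_cast hjN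
  exact Finset.mem_filter.2 ⟨Finset.mem_Icc.2 ⟨one_le, hjN.trans hND⟩, hcast.trans hNM⟩

/-- The remainder `σ² ln^{3/2}(1/σ) ∨ a_N⁻²` of the upper bound at the effective cut-off
`N = D ∧ M₀`. -/
noncomputable def remainder (a : ℕ+ → ℝ) (σ : ℝ) (N : ℕ+) : ℝ :=
  max (σ ^ 2 * Real.log (1 / σ) ^ (3 / 2 : ℝ)) (a N ^ 2)⁻¹

theorem tildeC_nonneg {α : ℝ} (hα : 0 < α) (hα₁ : α ≤ 1) (β C₀ : ℝ) : 0 ≤ tildeC α β C₀ := by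
  have : 0 ≤ Real.log (2 / α) := Real.log_nonneg ((one_le_div hα).2 (by linarith))
  unfold tildeC
  positivity

theorem log_add_log_le_tildeC {α β C₀ : ℝ} (hα : 0 < α) (hα₁ : α ≤ 1) (hαβ : α ≤ β)
    (hC₀ : C₀ ≠ 0) :
    6 * (Real.log (1 / α) + Real.log (1 / β) + 3 / 16) ≤ C₀ ^ 2 * tildeC α β C₀ := by
  have hlogα : 0 ≤ Real.log (1 / α) := Real.log_nonneg ((one_le_div hα).2 hα₁)
  have hlogβ : Real.log (1 / β) ≤ Real.log (1 / α) :=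
    Real.log_le_log (one_div_pos.2 (hα.trans_le hαβ)) (one_div_le_one_div_of_le hα hαβ)
  have hlog_two : Real.log (2 / α) = Real.log 2 + Real.log (1 / α) := by
    rw [← Real.log_mul two_ne_zero (one_div_pos.2 hα).ne', mul_one_div]
  rw [tildeC, mul_div_cancel₀ _ (pow_ne_zero 2 hC₀)]
  linarith [Real.sqrt_nonneg (Real.log (2 / α)), Real.sqrt_nonneg (Real.log (2 / β)),
    Real.log_two_gt_d9]

variable {a b : ℕ+ → ℝ} {α β C₀ C₁ ε σ τ : ℝ}

theorem upperTerm_eq_top_or_exists_le (hα : 0 < α) (hα₁ : α ≤ 1) (hσ : 0 ≤ σ) (D : ℕ+) :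
    upperTerm a b α β C₀ ε σ D = ⊤ ∨ ∃ N : ℕ+, σ * hZero α N < b N ∧
      ENNReal.ofReal (tildeC α β C₀ * (ε ^ 2 * √(∑ j ∈ Finset.Icc 1 N, (b j ^ 4)⁻¹)) +
        (7 + 4 * √(Real.log (2 / α))) * remainder a σ N) ≤ upperTerm a b α β C₀ ε σ D := by
  have hfactor : 0 < 7 + 4 * √(Real.log (2 / α)) := by positivity
  rcases invSq_toNat_min_eq_top_or a D (bandM₀ α σ b) with htop | ⟨N, hND, hNM, hinv⟩
  · left
    rw [upperTerm, htop, max_eq_right le_top, ENNReal.mul_top (ENNReal.ofReal_pos.2 hfactor).ne',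
      add_top]
  · refine Or.inr ⟨N, mul_hZero_lt_of_le_bandM₀ hNM le_rfl, ?_⟩
    have hC := tildeC_nonneg hα hα₁ β C₀
    have hsum := sum_Icc_le_sum_filter_natCast_le (f := fun j => (b j ^ 4)⁻¹)
      (fun j => by positivity) hND (le_bandM₁_of_le_bandM₀ hσ hNM)
    rw [upperTerm, hinv, ← ENNReal.ofReal_max, ← ENNReal.ofReal_mul hfactor.le]
    refine ENNReal.ofReal_add_le.trans (add_le_add_left (ENNReal.ofReal_le_ofReal ?_) _)
    rw [mul_assoc]
    gcongr

theorem minimaxRadius_sq_le_upperTerm {ζ : EllTwo → ℕ+ → ℝ × ℝ → ℝ} (hα : 0 < α) (hαβ : α ≤ β)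
    (hα₁ : α ≤ 1) (ha : ∀ j, 0 < a j) (ha_mono : Monotone a) (hb : ∀ j, 0 < b j) (hC₀ : 0 < C₀)
    (hε : 0 < ε) (hσ : 0 ≤ σ) (hζ : IsGaussianResidual (operatorClass C₀ C₁ b) ε σ τ ζ)
    (hbias : ∀ N : ℕ+, σ * hZero α N < b N → ∃ Bd : ℝ, 0 ≤ Bd ∧
      (∀ j ≤ N, τ ^ 2 * (a j * b j)⁻¹ ^ 2 ≤ Bd) ∧
      (Real.log (1 / α) + Real.log (1 / β) + 3 / 16) * Bd ≤ C₀ ^ 2 * remainder a σ N) (D : ℕ+) :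
    minimaxRadius a (operatorClass C₀ C₁ b) α β ε σ ^ 2 ≤ upperTerm a b α β C₀ ε σ D := by
  rcases upperTerm_eq_top_or_exists_le (a := a) (b := b) (β := β) (C₀ := C₀) (ε := ε) hα hα₁ hσ D
    with htop | ⟨N, hN, hle⟩
  · exact htop ▸ le_top
  obtain ⟨Bd, hBd₀, hBd, hBd_le⟩ := hbias N hN
  set A := ε ^ 2 * √(∑ j ∈ Finset.Icc 1 N, (b j ^ 4)⁻¹)
  set L := Real.log (1 / α) + Real.log (1 / β) + 3 / 16
  set U := tildeC α β C₀ * A + (7 + 4 * √(Real.log (2 / α))) * remainder a σ N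
  have hA : 0 ≤ A := by positivity
  have haN : 0 < (a N ^ 2)⁻¹ := inv_pos.2 (pow_pos (ha N) 2)
  have haN_le : (a N ^ 2)⁻¹ ≤ remainder a σ N := le_max_right _ _
  have hU_ge : tildeC α β C₀ * A + 7 * remainder a σ N ≤ U := by
    refine add_le_add_right (mul_le_mul_of_nonneg_right ?_ (haN.le.trans haN_le)) _
    linarith [Real.sqrt_nonneg (Real.log (2 / α))]
  have hU : 0 < U := by linarith [mul_nonneg (tildeC_nonneg hα hα₁ β C₀) hA]
  have hrad : 6 * (A + Bd) * L ≤ C₀ ^ 2 * (√U ^ 2 - (a N ^ 2)⁻¹) := by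
    rw [Real.sq_sqrt hU.le]
    calc 6 * (A + Bd) * L = 6 * L * A + 6 * (L * Bd) := by ring
      _ ≤ C₀ ^ 2 * tildeC α β C₀ * A + 6 * (C₀ ^ 2 * remainder a σ N) := add_le_add
        (mul_le_mul_of_nonneg_right (log_add_log_le_tildeC hα hα₁ hαβ hC₀.ne') hA)
        (mul_le_mul_of_nonneg_left hBd_le (by norm_num))
      _ = C₀ ^ 2 * (tildeC α β C₀ * A + 6 * remainder a σ N) := by ring
      _ ≤ C₀ ^ 2 * (U - (a N ^ 2)⁻¹) := by
        gcongr
        linarith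
  have hradius := minimaxRadius_le_of_isGaussianResidual hα (hα.trans_le hαβ) ha ha_mono hb hC₀.le
    hε hζ N hBd₀ hBd (Real.sqrt_pos.2 hU) hrad
  calc minimaxRadius a (operatorClass C₀ C₁ b) α β ε σ ^ 2
      ≤ ENNReal.ofReal √U ^ 2 := pow_le_pow_left₀ zero_le hradius 2
    _ = ENNReal.ofReal U := by rw [← ENNReal.ofReal_pow (Real.sqrt_nonneg _), Real.sq_sqrt hU.le]
    _ ≤ upperTerm a b α β C₀ ε σ D := hle

theorem minimaxRadius_sq_le_upperTerm_of_known_operator (hα : 0 < α) (hαβ : α ≤ β) (hα₁ : α ≤ 1)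
    (ha : ∀ j, 0 < a j) (ha_mono : Monotone a) (hb : ∀ j, 0 < b j) (hε : 0 < ε) (hσ : 0 ≤ σ)
    (D : ℕ+) : minimaxRadius a (operatorClass 1 1 b) α β ε σ ^ 2 ≤ upperTerm a b α β 1 ε σ D := by
  refine minimaxRadius_sq_le_upperTerm hα hαβ hα₁ ha ha_mono hb one_pos hε hσ
    (isGaussianResidual_of_known b ε σ) (fun N _ => ⟨0, le_rfl, fun j _ => by simp, ?_⟩) D
  have hremainder : 0 ≤ remainder a σ N := le_max_of_le_right (by positivity)
  simpa using hremainder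

theorem exists_forall_le_hZero_sq_or_le (hα : 0 < α) (hα₁ : α ≤ 1) (Q : ℝ) (y : ℕ+ → ℝ) :
    ∃ Λ, ∀ N : ℕ+, Q ≤ hZero α N ^ 2 ∨ y N ≤ Λ := by
  obtain ⟨n, hn⟩ := exists_nat_ge (Real.exp Q)
  have hfin : {N : ℕ+ | (N : ℕ) < n}.Finite :=
    Set.Finite.preimage PNat.coe_injective.injOn (Set.finite_lt_nat n)
  obtain ⟨Λ, hΛ⟩ := (hfin.image y).bddAbove
  refine ⟨Λ, fun N => ?_⟩
  rcases lt_or_ge (N : ℕ) n with hN | hN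
  · exact Or.inr (hΛ (Set.mem_image_of_mem y hN))
  · refine Or.inl (le_trans ?_ (log_le_hZero_sq hα hα₁ N))
    rw [Real.le_log_iff_exp_le (by exact_mod_cast N.pos)]
    exact hn.trans (by exact_mod_cast hN)

theorem exists_forall_le_log_rpow (Λ : ℝ) :
    ∃ σ₀ : ℝ, 0 < σ₀ ∧ σ₀ < 1 ∧ ∀ σ, 0 < σ → σ ≤ σ₀ → Λ ≤ Real.log (1 / σ) ^ (3 / 2 : ℝ) := by
  have hone : 1 ≤ max Λ 1 := le_max_right _ _
  refine ⟨Real.exp (-max Λ 1), Real.exp_pos _, Real.exp_lt_one_iff.2 (by linarith),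
    fun σ hσ hσ_le => ?_⟩
  have hlog : max Λ 1 ≤ Real.log (1 / σ) := by
    rw [one_div, Real.log_inv, le_neg]
    exact (Real.log_le_iff_le_exp hσ).2 hσ_le
  exact ((le_max_left _ _).trans hlog).trans
    (Real.self_le_rpow_of_one_le (hone.trans hlog) (by norm_num))

theorem mul_sq_max_le_remainder {N : ℕ+} {Q : ℝ} (ha : 0 < a N) (hb : 0 < b N) (hσ : 0 ≤ σ)
    (hN : σ * hZero α N < b N) (hQ : Q ≤ Real.log (1 / σ) ^ (3 / 2 : ℝ))
    (h : Q ≤ hZero α N ^ 2 ∨ Q * (a N * b N)⁻¹ ^ 2 ≤ Real.log (1 / σ) ^ (3 / 2 : ℝ)) :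
    σ ^ 2 * (Q * max 1 (a N * b N)⁻¹ ^ 2) ≤ remainder a σ N := by
  rcases le_total (a N * b N)⁻¹ 1 with hle | hge
  · rw [max_eq_left hle, one_pow, mul_one]
    exact le_max_of_le_left (mul_le_mul_of_nonneg_left hQ (sq_nonneg σ))
  rw [max_eq_right hge]
  rcases h with h | h
  · refine le_max_of_le_right ?_
    calc σ ^ 2 * (Q * (a N * b N)⁻¹ ^ 2)
        ≤ σ ^ 2 * (hZero α N ^ 2 * (a N * b N)⁻¹ ^ 2) := by gcongr
      _ = (σ * hZero α N) ^ 2 * (a N * b N)⁻¹ ^ 2 := by ring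
      _ ≤ b N ^ 2 * (a N * b N)⁻¹ ^ 2 := by
        gcongr
        exact mul_nonneg hσ (hZero_nonneg α N)
      _ = (a N ^ 2)⁻¹ := by field_simp
  · exact le_max_of_le_left (mul_le_mul_of_nonneg_left h (sq_nonneg σ))

theorem exists_minimaxRadius_sq_le_upperTerm_of_almostMonotone (hα : 0 < α) (hαβ : α ≤ β)
    (hα₁ : α ≤ 1) (ha : ∀ j, 0 < a j) (ha_mono : Monotone a) (hb : ∀ j, 0 < b j) (hC₀ : 0 < C₀)
    (C₁ : ℝ) (hab : BoundedOrAlmostMonotone a b) :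
    ∃ σ₀ : ℝ, 0 < σ₀ ∧ σ₀ < 1 ∧ ∀ σ, 0 < σ → σ ≤ σ₀ → ∀ ε, 0 < ε → ∀ D : ℕ+,
      minimaxRadius a (operatorClass C₀ C₁ b) α β ε σ ^ 2 ≤ upperTerm a b α β C₀ ε σ D := by
  obtain ⟨K, hK⟩ := hab
  set L := Real.log (1 / α) + Real.log (1 / β) + 3 / 16
  set Q := L * K ^ 2 / C₀ ^ 2 with hQ
  obtain ⟨Λ, hΛ⟩ := exists_forall_le_hZero_sq_or_le hα hα₁ Q fun N => Q * (a N * b N)⁻¹ ^ 2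
  obtain ⟨σ₀, hσ₀, hσ₀_lt, hlog⟩ := exists_forall_le_log_rpow (max Q Λ)
  refine ⟨σ₀, hσ₀, hσ₀_lt, fun σ hσ hσ_le ε hε => minimaxRadius_sq_le_upperTerm hα hαβ hα₁ ha
    ha_mono hb hC₀ hε hσ.le (isGaussianResidual_of_unknown _ ε σ) fun N hN =>
    ⟨σ ^ 2 * (K * max 1 (a N * b N)⁻¹) ^ 2, by positivity, fun j hj => ?_, ?_⟩⟩
  · exact mul_le_mul_of_nonneg_left (pow_le_pow_left₀
      (inv_nonneg.2 (mul_pos (ha j) (hb j)).le) (hK j N hj) 2) (sq_nonneg σ)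
  · have hlogσ := hlog σ hσ hσ_le
    calc L * (σ ^ 2 * (K * max 1 (a N * b N)⁻¹) ^ 2)
        = C₀ ^ 2 * (σ ^ 2 * (Q * max 1 (a N * b N)⁻¹ ^ 2)) := by
          rw [hQ]
          field_simp
      _ ≤ C₀ ^ 2 * remainder a σ N := mul_le_mul_of_nonneg_left
          (mul_sq_max_le_remainder (ha N) (hb N) hσ.le hN ((le_max_left _ _).trans hlogσ)
            ((hΛ N).imp_right fun h => (h.trans (le_max_right _ _)).trans hlogσ))
          (sq_nonneg C₀)

end Cutoff

end GoF

theorem theorem1_general (α β : ℝ) (hα : 0 < α) (hβ₀ : 0 < β) (hβ : β < 1)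
    (a : ℕ+ → ℝ) (ha_pos : ∀ j, 0 < a j) (ha_mono : Monotone a)
    (b : ℕ+ → ℝ) (hb_pos : ∀ j, 0 < b j)
    (C₀ C₁ : ℝ) (hC₀ : 0 < C₀) (hC₀' : C₀ ≤ 1) (hC₁ : 1 ≤ C₁) :
    (α ≤ β → (C₀ = 1 ∧ C₁ = 1) ∨ GoF.BoundedOrAlmostMonotone a b →
      ∃ σ₀ : ℝ, 0 < σ₀ ∧ σ₀ < 1 ∧ ∀ σ : ℝ, 0 < σ → σ ≤ σ₀ → ∀ ε : ℝ, 0 < ε →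
        GoF.minimaxRadius a (GoF.operatorClass C₀ C₁ b) α β ε σ ^ 2 ≤
          ⨅ D : ℕ+, GoF.upperTerm a b α β C₀ ε σ D) ∧
    (α + β < 1 → ∀ ε : ℝ, 0 < ε → ∀ σ : ℝ, 0 < σ →
      (Antitone b → GoF.lowerSigma a b α β C₀ C₁ σ ≤
        GoF.minimaxRadius a (GoF.operatorClass C₀ C₁ b) α β ε σ ^ 2) ∧
      GoF.lowerEps a b α β ε ≤ GoF.minimaxRadius a (GoF.operatorClass C₀ C₁ b) α β ε σ ^ 2) := by
  refine ⟨fun hαβ h => ?_, fun hsum ε hε σ hσ => ⟨fun hanti => ?_, ?_⟩⟩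
  · have hα₁ : α ≤ 1 := hαβ.trans hβ.le
    rcases h with ⟨rfl, rfl⟩ | hab
    · exact ⟨1 / 2, by norm_num, by norm_num, fun σ hσ _ ε hε => le_iInf
        (GoF.minimaxRadius_sq_le_upperTerm_of_known_operator hα hαβ hα₁ ha_pos ha_mono hb_pos hε
          hσ.le)⟩
    · obtain ⟨σ₀, hσ₀, hσ₀_lt, hbound⟩ :=
        GoF.exists_minimaxRadius_sq_le_upperTerm_of_almostMonotone hα hαβ hα₁ ha_pos ha_mono
          hb_pos hC₀ C₁ hab
      exact ⟨σ₀, hσ₀, hσ₀_lt, fun σ hσ hσ_le ε hε => le_iInf (hbound σ hσ hσ_le ε hε)⟩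
  · exact GoF.lowerSigma_le_minimaxRadius_sq hα hβ₀ hsum hC₀' hC₁ ha_pos hb_pos hanti ε hσ
  · exact GoF.lowerEps_le_minimaxRadius_sq hα.le hβ₀.le hsum ha_pos ha_mono hb_pos
      (GoF.self_mem_operatorClass hb_pos hC₀' hC₁) hε σ

theorem theorem1 (α β : ℝ) (hα : 0 < α) (hαβ : α ≤ β) (hβ : β < 1)
    (a : ℕ+ → ℝ) (ha_pos : ∀ j, 0 < a j) (ha_mono : Monotone a) (ha_lim : Tendsto a atTop atTop)
    (b : ℕ+ → ℝ) (hb_pos : ∀ j, 0 < b j)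
    (C₀ C₁ : ℝ) (hC₀ : 0 < C₀) (hC₀' : C₀ ≤ 1) (hC₁ : 1 ≤ C₁) :
    ((C₀ = 1 ∧ C₁ = 1) ∨ GoF.BoundedOrAlmostMonotone a b →
      ∃ σ₀ : ℝ, 0 < σ₀ ∧ σ₀ < 1 ∧ ∀ σ : ℝ, 0 < σ → σ ≤ σ₀ → ∀ ε : ℝ, 0 < ε →
        GoF.minimaxRadius a (GoF.operatorClass C₀ C₁ b) α β ε σ ^ 2 ≤
          ⨅ D : ℕ+, GoF.upperTerm a b α β C₀ ε σ D) ∧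
    (α + β < 1 → Antitone b → ∀ ε : ℝ, 0 < ε → ∀ σ : ℝ, 0 < σ →
      max (GoF.lowerSigma a b α β C₀ C₁ σ) (GoF.lowerEps a b α β ε) ≤
        GoF.minimaxRadius a (GoF.operatorClass C₀ C₁ b) α β ε σ ^ 2) := by
  obtain ⟨hupper, hlower⟩ := theorem1_general α β hα (hα.trans_le hαβ) hβ a ha_pos ha_mono b hb_pos
    C₀ C₁ hC₀ hC₀' hC₁
  exact ⟨hupper hαβ, fun hsum hanti ε hε σ hσ =>
    max_le ((hlower hsum ε hε σ hσ).1 hanti) (hlower hsum ε hε σ hσ).2⟩
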